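/- Let $W_n$ ($n=0,1,2,\dots$) be the Walsh functions on $[0,1]$: $W_0\equiv 1$ and, for $n=2^{k_1}+\dots+2^{k_s}$ with $k_1>\dots>k_s\ge 0$, $W_n(x)=\prod_{i=1}^{s}R_{k_i+1}(x)$, where $R_j(x)=\operatorname{sign}(\sin 2^j\pi x)$. For $g\in L^1[0,1]$ put $c_k(g)=\int_0^1 g(x)W_k(x)\,dx$. For a measurable weight $\mu$ on $[0,1]$ with $0<\mu(x)\le 1$ and $p\ge 1$ let $L^p_\mu[0,1]$ be the class of all real-valued measurable functions $f$ on $[0,1]$ with $\int_0^1|f(x)|^p\mu(x)\,dx<\infty$. Theorem. For every $\varepsilon>0$ there exist a real-valued function $g\in L^1[0,1]$ and a measurable weight $\mu$ on $[0,1]$ with $0<\mu(x)\le 1$ for all $x\in[0,1]$ and $|\{x\in[0,1]:\mu(x)=1\}|>1-\varepsilon$ such that: (i) $c_k(g)>c_{k+1}(g)>0$ for all $k\ge 0$; (ii) the Fourier--Walsh series of $g$ converges to $g$ in $L^1[0,1]$, i.e. $\lim_{m\to\infty}\int_0^1\left|\sum_{k=0}^m c_k(g)W_k(x)-g(x)\right|dx=0$;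 (iii) for every $p\ge 1$ and every $f\in L^p_\mu[0,1]$ there are numbers $\delta_k\in\{-1,0,1\}$, $k\ge 0$, such that $$\lim_{m\to\infty}\int_0^1\left|\sum_{k=0}^m\delta_k c_k(g)W_k(x)-f(x)\right|^p\mu(x)\,dx=0 .$$ -/

import Mathlib

open MeasureTheory Set Filter Topology

namespace WalshUniversal

noncomputable section

/-- Rademacher's functions `R_n(x) = sign (sin (2^n π x))`. -/
def rademacher (n : ℕ) (x : ℝ) : ℝ := Real.sign (Real.sin (2 ^ n * Real.pi * x))

/-- The Walsh functions in Paley's ordering: `W_n = ∏ R_{k+1}`, the product over the positions `k`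
of the binary digits `1` of `n` (all of them are `< n`); in particular `W_0 = 1`. -/
def walsh (n : ℕ) (x : ℝ) : ℝ :=
  ∏ k ∈ (Finset.range n).filter (fun k => n.testBit k = true), rademacher (k + 1) x

/-- The Fourier--Walsh coefficients `c_k(g) = ∫_0^1 g W_k dx`. -/
def walshCoeff (g : ℝ → ℝ) (k : ℕ) : ℝ := ∫ x in Icc (0 : ℝ) 1, g x * walsh k x

/-- `∫_0^1 |f|^p μ dx`, as an extended nonnegative number. -/
def weightedIntegral (μ : ℝ → ℝ) (p : ℝ) (f : ℝ → ℝ) : ENNReal :=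
  ∫⁻ x in Icc (0 : ℝ) 1, ENNReal.ofReal (|f x| ^ p * μ x)

/-- Membership in the weighted space `L^p_μ[0,1]`: `f` is Lebesgue measurable on `[0,1]` and
`∫_0^1 |f|^p μ dx < ∞`. -/
def MemWeightedLp (μ : ℝ → ℝ) (p : ℝ) (f : ℝ → ℝ) : Prop :=
  AEStronglyMeasurable f (volume.restrict (Icc (0 : ℝ) 1)) ∧ weightedIntegral μ p f < ⊤

/-- `g` is universal for the class `L^p_μ[0,1]` with respect to signs-subseries of its
Fourier--Walsh series: for each `f` in the class one can choose `δ_k ∈ {-1, 0, 1}` such that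
`∫_0^1 |∑_{k=0}^m δ_k c_k(g) W_k - f|^p μ dx → 0` as `m → ∞`. -/
def IsUniversalFor (g μ : ℝ → ℝ) (p : ℝ) : Prop :=
  ∀ f : ℝ → ℝ, MemWeightedLp μ p f →
    ∃ δ : ℕ → ℝ, (∀ k, δ k = -1 ∨ δ k = 0 ∨ δ k = 1) ∧
      Tendsto
        (fun m : ℕ => weightedIntegral μ p
          (fun x => (∑ k ∈ Finset.range (m + 1), δ k * walshCoeff g k * walsh k x) - f x))
        atTop (𝓝 0)

end

end WalshUniversal

/-!
# Universal Walsh series with decreasing coefficients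

Outside the dyadic rationals, the Walsh functions are the characters `cwalsh n` of the Cantor space
`ℕ → Bool` evaluated at the binary digits of `x`, so everything except the final norm estimates is
combinatorics of characters and of cylinders.

**Fair bets.** Let `F` be a union of cylinders of level `m` and `u` a stake. The indicator of a
cylinder of level `m` has the Walsh coefficients `± 2 ^ (-m)` on `[0, 2 ^ m)`. Shifting the
indicators of different cylinders by different multiples of `2 ^ m` inside the single dyadic block
`[2 ^ (2 m), 2 ^ (2 m + 1))` gives a polynomial equal to `± u` on `F` and to `0` elsewhere, all of
whose nonzero coefficients have the same absolute value `|u| / 2 ^ m` (`psum_betCoeff_full`). As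
`m` is at our disposal, this value is as small as desired.

**Doubling.** Betting `u, 2 u, 4 u, …` on the points where all previous bets were lost produces the
value `u` on `F` except on a set of relative measure `2 ^ (-k)`
(`exists_block_of_subset_cell`). Partial sums may be large on the way, but only within `F`.
Treating the cylinders of a very fine level one after another therefore yields, for any step
function `v`, a polynomial that equals `v` off a small set `B` and whose partial sums are dominated
by `|v|` off `B` and off one tiny cylinder (`exists_block`). Its nonzero coefficients are
nonincreasing in absolute value and start as late and as low as desired.

**The function.** Such blocks for an enumeration of the rational step functions, each repeated
infinitely often, are put in a row. Their coefficients are `θ k * c k` with `θ k ∈ {-1, 0, 1}` and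
`c` strictly decreasing, up to a negligible error (`exists_strictAnti_coeff_of_blocks`). The
Lebesgue constants of the Walsh system grow logarithmically and `c k` decays like a power of `k`,
so by Abel summation `∑ c k W_k` converges in `L¹`, to a function `g` with Walsh coefficients `c k`
(`exists_integrable_of_coeff`).

**The weight and universality.** The weight is `1` off the union of the exceptional sets `B s` and
so small on `B s` that the behaviour of block `s` there does not matter (`exists_weight`). Given
`f`, the blocks are examined one after another, and a block is included exactly when it is sure
to halve the norm of the current remainder; by density of the rational step functions this happens again and
again (`exists_greedy_subseries`), and the signed subseries thus selected converges to `f`.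
-/

open MeasureTheory Set Filter Topology

namespace WalshUniversal

/-! ### Walsh functions on the Cantor space -/

/-- The `n`-th Walsh function on the space `ℕ → Bool` of binary expansions: the character
`ω ↦ (-1) ^ #{k | bit k of n is 1 and ω k = true}`. -/
def cwalsh (n : ℕ) (ω : ℕ → Bool) : ℝ :=
  ∏ k ∈ Finset.range n, if n.testBit k && ω k then -1 else 1

lemma cwalsh_eq_prod {n L : ℕ} (h : n < 2 ^ L) (ω : ℕ → Bool) :
    cwalsh n ω = ∏ k ∈ Finset.range L, if n.testBit k && ω k then (-1 : ℝ) else 1 := by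
  have key : ∀ A B : ℕ, n < 2 ^ A → A ≤ B →
      ∏ k ∈ Finset.range A, (if n.testBit k && ω k then (-1 : ℝ) else 1) =
        ∏ k ∈ Finset.range B, if n.testBit k && ω k then (-1 : ℝ) else 1 := by
    intro A B hA hAB
    refine Finset.prod_subset (Finset.range_mono hAB) fun k _ hk => ?_
    rw [Finset.mem_range, not_lt] at hk
    rw [Nat.testBit_lt_two_pow (hA.trans_le (Nat.pow_le_pow_right two_pos hk))]
    simp
  rw [cwalsh, key n (max n L) Nat.lt_two_pow_self (le_max_left _ _),
    key L (max n L) h (le_max_right _ _)]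

lemma cwalsh_eq_one_or (n : ℕ) (ω : ℕ → Bool) : cwalsh n ω = 1 ∨ cwalsh n ω = -1 := by
  unfold cwalsh
  refine Finset.prod_induction _ (fun y : ℝ => y = 1 ∨ y = -1) ?_ (Or.inl rfl) ?_
  · rintro a b (rfl | rfl) (rfl | rfl) <;> norm_num
  · intro k _
    split_ifs <;> simp

@[simp] lemma abs_cwalsh (n : ℕ) (ω : ℕ → Bool) : |cwalsh n ω| = 1 := by
  rcases cwalsh_eq_one_or n ω with h | h <;> simp [h]

lemma cwalsh_mul_self (n : ℕ) (ω : ℕ → Bool) : cwalsh n ω * cwalsh n ω = 1 := by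
  rcases cwalsh_eq_one_or n ω with h | h <;> simp [h]

@[simp] lemma cwalsh_zero (ω : ℕ → Bool) : cwalsh 0 ω = 1 := by simp [cwalsh]

lemma cwalsh_xor (a b : ℕ) (ω : ℕ → Bool) :
    cwalsh (a ^^^ b) ω = cwalsh a ω * cwalsh b ω := by
  have hlt : ∀ n ≤ max a (max b (a ^^^ b)), n < 2 ^ max a (max b (a ^^^ b)) :=
    fun n hn => hn.trans_lt Nat.lt_two_pow_self
  rw [cwalsh_eq_prod (hlt a (by simp)), cwalsh_eq_prod (hlt b (by simp)),
    cwalsh_eq_prod (hlt (a ^^^ b) (by simp)), ← Finset.prod_mul_distrib]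
  refine Finset.prod_congr rfl fun k _ => ?_
  rw [Nat.testBit_xor]
  cases a.testBit k <;> cases b.testBit k <;> cases ω k <;> simp

lemma cwalsh_mul_cwalsh (n : ℕ) (ω ω' : ℕ → Bool) :
    cwalsh n ω * cwalsh n ω' = cwalsh n (fun k => xor (ω k) (ω' k)) := by
  unfold cwalsh
  rw [← Finset.prod_mul_distrib]
  refine Finset.prod_congr rfl fun k _ => ?_
  cases n.testBit k <;> cases h : ω k <;> cases h' : ω' k <;> simp [h, h']

lemma cwalsh_two_pow_mul_add {m j : ℕ} (q : ℕ) (hj : j < 2 ^ m) (ω : ℕ → Bool) :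
    cwalsh (2 ^ m * q + j) ω = cwalsh (2 ^ m * q) ω * cwalsh j ω := by
  rw [← cwalsh_xor]
  congr 1
  refine Nat.eq_of_testBit_eq fun i => ?_
  have h0 := Nat.testBit_two_pow_mul_add q (Nat.two_pow_pos m) i
  rw [add_zero] at h0
  rw [Nat.testBit_xor, Nat.testBit_two_pow_mul_add q hj, h0]
  split_ifs with h
  · simp
  · rw [Nat.testBit_lt_two_pow (hj.trans_le (Nat.pow_le_pow_right two_pos (not_lt.1 h)))]
    simp

lemma cwalsh_two_pow_add {m j : ℕ} (hj : j < 2 ^ m) (ω : ℕ → Bool) :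
    cwalsh (2 ^ m + j) ω = cwalsh (2 ^ m) ω * cwalsh j ω := by
  simpa using cwalsh_two_pow_mul_add 1 hj ω

lemma cwalsh_two_pow (m : ℕ) (ω : ℕ → Bool) :
    cwalsh (2 ^ m) ω = if ω m then -1 else 1 := by
  rw [cwalsh_eq_prod (Nat.pow_lt_pow_right one_lt_two (Nat.lt_succ_self m)),
    Finset.prod_range_succ, Finset.prod_eq_one]
  · simp [Nat.testBit_two_pow_self]
  · intro k hk
    rw [Finset.mem_range] at hk
    rw [Nat.testBit_two_pow_of_ne (by omega)]
    simp

lemma cwalsh_congr {n m : ℕ} (hn : n < 2 ^ m) {ω ω' : ℕ → Bool} (h : ∀ k < m, ω k = ω' k) :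
    cwalsh n ω = cwalsh n ω' := by
  rw [cwalsh_eq_prod hn, cwalsh_eq_prod hn]
  refine Finset.prod_congr rfl fun k hk => ?_
  rw [h k (Finset.mem_range.1 hk)]

/-- The Dirichlet kernel of order `2 ^ m` in product form; in particular it is nonnegative. -/
lemma sum_cwalsh_eq_prod (m : ℕ) (ω : ℕ → Bool) :
    ∑ j ∈ Finset.range (2 ^ m), cwalsh j ω =
      ∏ k ∈ Finset.range m, (1 + if ω k then (-1 : ℝ) else 1) := by
  induction m with
  | zero => simp
  | succ m ih =>
    rw [Finset.prod_range_succ, ← ih, pow_succ, mul_two, Finset.sum_range_add, mul_add, mul_one,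
      ← cwalsh_two_pow, Finset.sum_mul]
    congr 1
    refine Finset.sum_congr rfl fun j hj => ?_
    rw [cwalsh_two_pow_add (Finset.mem_range.1 hj), mul_comm]

lemma sum_cwalsh_nonneg (m : ℕ) (ω : ℕ → Bool) :
    0 ≤ ∑ j ∈ Finset.range (2 ^ m), cwalsh j ω := by
  rw [sum_cwalsh_eq_prod]
  exact Finset.prod_nonneg fun k _ => by split_ifs <;> norm_num

lemma sum_cwalsh_mul_of_agree {m : ℕ} {ω ω' : ℕ → Bool} (h : ∀ k < m, ω k = ω' k) :
    ∑ j ∈ Finset.range (2 ^ m), cwalsh j ω * cwalsh j ω' = 2 ^ m := by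
  rw [Finset.sum_congr rfl fun j hj => by
    rw [cwalsh_congr (Finset.mem_range.1 hj) h, cwalsh_mul_self]]
  simp

lemma sum_cwalsh_mul_of_not_agree {m : ℕ} {ω ω' : ℕ → Bool} (h : ¬ ∀ k < m, ω k = ω' k) :
    ∑ j ∈ Finset.range (2 ^ m), cwalsh j ω * cwalsh j ω' = 0 := by
  push Not at h
  obtain ⟨k, hk, hne⟩ := h
  simp_rw [cwalsh_mul_cwalsh]
  rw [sum_cwalsh_eq_prod]
  refine Finset.prod_eq_zero (Finset.mem_range.2 hk) ?_
  rw [show (xor (ω k) (ω' k)) = true by simpa using hne]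
  norm_num

lemma sum_range_mul_add {M : Type*} [AddCommMonoid M] (f : ℕ → M) (d q r : ℕ) :
    ∑ t ∈ Finset.range (d * q + r), f t =
      ∑ i ∈ Finset.range q, ∑ j ∈ Finset.range d, f (d * i + j) +
        ∑ j ∈ Finset.range r, f (d * q + j) := by
  rw [Finset.sum_range_add]
  congr 1
  induction q with
  | zero => simp
  | succ q ih => rw [mul_add, mul_one, Finset.sum_range_add, ih, Finset.sum_range_succ]

/-- Partial sums of the Dirichlet kernel are localized: they stay bounded by `2 ^ ρ` at pairs of
points that are separated by their first `ρ` digits, because full blocks of length `2 ^ ρ`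
cancel there. -/
lemma abs_sum_cwalsh_mul_le {ρ : ℕ} {ω ω' : ℕ → Bool} (h : ¬ ∀ k < ρ, ω k = ω' k) (J : ℕ) :
    |∑ j ∈ Finset.range J, cwalsh j ω * cwalsh j ω'| ≤ 2 ^ ρ := by
  have hr : J % 2 ^ ρ < 2 ^ ρ := Nat.mod_lt _ (Nat.two_pow_pos ρ)
  rw [← Nat.div_add_mod J (2 ^ ρ), sum_range_mul_add, Finset.sum_eq_zero, zero_add]
  · refine (Finset.abs_sum_le_sum_abs _ _).trans ?_
    simp only [abs_mul, abs_cwalsh, mul_one, Finset.sum_const, Finset.card_range, nsmul_eq_mul]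
    exact_mod_cast hr.le
  · intro i _
    rw [Finset.sum_congr rfl fun j hj => by
      rw [cwalsh_two_pow_mul_add i (Finset.mem_range.1 hj),
        cwalsh_two_pow_mul_add i (Finset.mem_range.1 hj), mul_mul_mul_comm],
      ← Finset.mul_sum, sum_cwalsh_mul_of_not_agree h, mul_zero]

/-- The number with binary digits `ω 0, …, ω (m - 1)` (lowest first); it labels the cylinder of
level `m` that contains `ω`. -/
def cell (m : ℕ) (ω : ℕ → Bool) : ℕ := Nat.ofBits fun k : Fin m => ω k

lemma cell_lt (m : ℕ) (ω : ℕ → Bool) : cell m ω < 2 ^ m := Nat.ofBits_lt_two_pow _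

lemma testBit_cell {m k : ℕ} (hk : k < m) (ω : ℕ → Bool) : (cell m ω).testBit k = ω k :=
  Nat.testBit_ofBits_lt _ _ hk

lemma cell_testBit {m i : ℕ} (hi : i < 2 ^ m) : cell m i.testBit = i := by
  rw [cell, Nat.ofBits_testBit, Nat.mod_eq_of_lt hi]

lemma cell_eq_iff {m : ℕ} {ω ω' : ℕ → Bool} :
    cell m ω = cell m ω' ↔ ∀ k < m, ω k = ω' k := by
  constructor
  · intro h k hk
    rw [← testBit_cell hk ω, h, testBit_cell hk]
  · intro h
    exact congrArg Nat.ofBits (funext fun k => h k k.2)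

lemma cell_mono {m n : ℕ} (hmn : m ≤ n) {ω ω' : ℕ → Bool} (h : cell n ω = cell n ω') :
    cell m ω = cell m ω' :=
  cell_eq_iff.2 fun k hk => cell_eq_iff.1 h k (hk.trans_le hmn)

lemma cell_testBit_cell (m : ℕ) (ω : ℕ → Bool) : cell m (cell m ω).testBit = cell m ω :=
  cell_testBit (cell_lt m ω)

/-- `S` is a union of cylinders of level `m`. -/
def IsLevel (m : ℕ) (S : Set (ℕ → Bool)) : Prop :=
  ∀ ω ω', cell m ω = cell m ω' → ω ∈ S → ω' ∈ S

lemma IsLevel.mono {m n : ℕ} (hmn : m ≤ n) {S : Set (ℕ → Bool)} (h : IsLevel m S) :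
    IsLevel n S := fun ω ω' hω => h ω ω' (cell_mono hmn hω)

lemma isLevel_cell (m i : ℕ) : IsLevel m {ω | cell m ω = i} := fun _ _ h h' => h.symm.trans h'

lemma measurable_cell (m : ℕ) : Measurable (cell m) := by
  have : Measurable fun (ω : ℕ → Bool) (k : Fin m) => ω k :=
    measurable_pi_lambda _ fun k => measurable_pi_apply _
  exact (measurable_of_countable fun w : Fin m → Bool => Nat.ofBits w).comp this

lemma IsLevel.measurableSet {m : ℕ} {S : Set (ℕ → Bool)} (h : IsLevel m S) :
    MeasurableSet S := by
  have : S = cell m ⁻¹' (cell m '' S) := by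
    refine (subset_preimage_image _ _).antisymm ?_
    rintro ω ⟨ω', hω', he⟩
    exact h ω' ω he hω'
  rw [this]
  exact measurable_cell m (MeasurableSet.of_discrete)

lemma measurable_cwalsh (n : ℕ) : Measurable (cwalsh n) := by
  unfold cwalsh
  refine Finset.measurable_prod _ fun k _ => ?_
  exact (measurable_of_countable fun b : Bool => if n.testBit k && b then (-1 : ℝ) else 1).comp
    (measurable_pi_apply k)

/-- The partial sum of length `M` of the Walsh series with coefficients `a`. -/
def psum (a : ℕ → ℝ) (M : ℕ) (ω : ℕ → Bool) : ℝ := ∑ k ∈ Finset.range M, a k * cwalsh k ω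

lemma psum_add (a a' : ℕ → ℝ) (M : ℕ) (ω : ℕ → Bool) :
    psum (a + a') M ω = psum a M ω + psum a' M ω := by
  simp [psum, add_mul, Finset.sum_add_distrib]

lemma psum_eq_zero {a : ℕ → ℝ} {M : ℕ} (h : ∀ k < M, a k = 0) (ω : ℕ → Bool) :
    psum a M ω = 0 :=
  Finset.sum_eq_zero fun k hk => by rw [h k (Finset.mem_range.1 hk), zero_mul]

lemma psum_eq_of_le {a : ℕ → ℝ} {R M : ℕ} (h : ∀ k, R ≤ k → a k = 0) (hM : R ≤ M)
    (ω : ℕ → Bool) : psum a M ω = psum a R ω := by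
  refine (Finset.sum_subset (Finset.range_mono hM) fun k _ hk => ?_).symm
  rw [h k (by simpa using hk), zero_mul]

/-! ### A single fair bet -/

/-- Coefficients on the dyadic block `[2 ^ (2 * m), 2 ^ (2 * m + 1))`, all of absolute value
`|u| / 2 ^ m` or `0`. For `i, j < 2 ^ m` the frequency `2 ^ (2 * m) + 2 ^ m * i + j` carries the
coefficient of index `j` of the indicator of the cylinder number `i` of level `m`, provided that
this cylinder lies in `F`. -/
noncomputable def betCoeff (F : Set (ℕ → Bool)) (m : ℕ) (u : ℝ) (k : ℕ) : ℝ :=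
  if 2 ^ (2 * m) ≤ k ∧ k < 2 ^ (2 * m + 1) then
    F.indicator (fun ζ => u / 2 ^ m * cwalsh (k % 2 ^ m) ζ) ((k - 2 ^ (2 * m)) / 2 ^ m).testBit
  else 0

/-- The outcome of the bet at `ω`: the frequency used on the cylinder of `ω` depends on that
cylinder, so that different cylinders never compete for the same coefficient. -/
noncomputable def betSign (m : ℕ) (ω : ℕ → Bool) : ℝ := cwalsh (2 ^ (2 * m) + 2 ^ m * cell m ω) ω

lemma betCoeff_eq_zero_of_lt {F : Set (ℕ → Bool)} {m k : ℕ} {u : ℝ} (h : k < 2 ^ (2 * m)) :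
    betCoeff F m u k = 0 := if_neg fun h' => absurd h'.1 (not_le.2 h)

lemma betCoeff_eq_zero_of_le {F : Set (ℕ → Bool)} {m k : ℕ} {u : ℝ} (h : 2 ^ (2 * m + 1) ≤ k) :
    betCoeff F m u k = 0 := if_neg fun h' => absurd h'.2 (not_lt.2 h)

lemma abs_betCoeff_of_ne {F : Set (ℕ → Bool)} {m k : ℕ} {u : ℝ} (h : betCoeff F m u k ≠ 0) :
    |betCoeff F m u k| = |u| / 2 ^ m := by
  classical
  unfold betCoeff at h ⊢
  split_ifs at h ⊢
  · rw [Set.indicator_apply] at h ⊢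
    split_ifs at h ⊢
    · rw [abs_mul, abs_cwalsh, mul_one, abs_div, abs_of_pos (by positivity : (0 : ℝ) < 2 ^ m)]
    · exact absurd rfl h
  · exact absurd rfl h

lemma betCoeff_mul_cwalsh (F : Set (ℕ → Bool)) {m i j : ℕ} (u : ℝ) (hi : i < 2 ^ m)
    (hj : j < 2 ^ m) (ω : ℕ → Bool) :
    betCoeff F m u (2 ^ (2 * m) + (2 ^ m * i + j)) * cwalsh (2 ^ (2 * m) + (2 ^ m * i + j)) ω =
      cwalsh (2 ^ (2 * m) + 2 ^ m * i) ω * F.indicator (fun _ => u / 2 ^ m) i.testBit *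
        (cwalsh j i.testBit * cwalsh j ω) := by
  have h1 : 2 ^ (2 * m) + (2 ^ m * i + j) = 2 ^ m * (2 ^ m + i) + j := by ring
  have h2 : 2 ^ (2 * m) + 2 ^ m * i = 2 ^ m * (2 ^ m + i) := by ring
  have h3 : 2 ^ m * i + j < 2 ^ (2 * m) := by
    calc 2 ^ m * i + j < 2 ^ m * i + 2 ^ m := by omega
      _ = 2 ^ m * (i + 1) := by ring
      _ ≤ 2 ^ m * 2 ^ m := Nat.mul_le_mul_left _ hi
      _ = 2 ^ (2 * m) := by ring
  have hc : betCoeff F m u (2 ^ (2 * m) + (2 ^ m * i + j)) =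
      F.indicator (fun _ => u / 2 ^ m) i.testBit * cwalsh j i.testBit := by
    classical
    unfold betCoeff
    rw [if_pos ⟨by omega, by rw [pow_succ]; omega⟩, Nat.add_sub_cancel_left,
      Nat.mul_add_div (Nat.two_pow_pos m), Nat.div_eq_of_lt hj, add_zero, h1, Nat.mul_add_mod,
      Nat.mod_eq_of_lt hj]
    simp only [Set.indicator_apply]
    split_ifs <;> simp
  rw [hc, h1, cwalsh_two_pow_mul_add _ hj, h2]
  ring

lemma psum_betCoeff (F : Set (ℕ → Bool)) {m q r : ℕ} (u : ℝ) (hq : q ≤ 2 ^ m) (hr : r ≤ 2 ^ m)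
    (hqr : q < 2 ^ m ∨ r = 0) (ω : ℕ → Bool) :
    psum (betCoeff F m u) (2 ^ (2 * m) + (2 ^ m * q + r)) ω =
      (if cell m ω < q then
        betSign m ω * F.indicator (fun _ => u) (cell m ω).testBit else 0) +
      cwalsh (2 ^ (2 * m) + 2 ^ m * q) ω * F.indicator (fun _ => u / 2 ^ m) q.testBit *
        ∑ j ∈ Finset.range r, cwalsh j q.testBit * cwalsh j ω := by
  rw [psum, Finset.sum_range_add, Finset.sum_eq_zero, zero_add, sum_range_mul_add]
  · congr 1
    · have hin : ∀ i ∈ Finset.range q, ∑ j ∈ Finset.range (2 ^ m),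
          betCoeff F m u (2 ^ (2 * m) + (2 ^ m * i + j)) *
            cwalsh (2 ^ (2 * m) + (2 ^ m * i + j)) ω =
          if i = cell m ω then betSign m ω * F.indicator (fun _ => u) (cell m ω).testBit
            else 0 := by
        intro i hi
        have hi' : i < 2 ^ m := (Finset.mem_range.1 hi).trans_le hq
        rw [Finset.sum_congr rfl fun j hj =>
          betCoeff_mul_cwalsh F u hi' (Finset.mem_range.1 hj) ω, ← Finset.mul_sum]
        classical
        split_ifs with h
        · rw [sum_cwalsh_mul_of_agree, h, betSign, Set.indicator_apply, Set.indicator_apply]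
          · split_ifs
            · field_simp
            · simp
          · exact fun k hk => by rw [h, testBit_cell hk]
        · rw [sum_cwalsh_mul_of_not_agree, mul_zero]
          intro h'
          exact h ((cell_testBit hi').symm.trans (cell_eq_iff.2 h'))
      rw [Finset.sum_congr rfl hin, Finset.sum_ite_eq' (Finset.range q) (cell m ω)]
      simp only [Finset.mem_range]
    · rcases hqr with hq' | rfl
      · rw [Finset.mul_sum]
        exact Finset.sum_congr rfl fun j hj =>
          betCoeff_mul_cwalsh F u hq' ((Finset.mem_range.1 hj).trans_le hr) ω
      · simp
  · intro k hk
    rw [betCoeff_eq_zero_of_lt (Finset.mem_range.1 hk), zero_mul]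

lemma psum_betCoeff_full {F : Set (ℕ → Bool)} {m : ℕ} (hF : IsLevel m F) (u : ℝ)
    (ω : ℕ → Bool) :
    psum (betCoeff F m u) (2 ^ (2 * m + 1)) ω = u * betSign m ω * F.indicator 1 ω := by
  have h : 2 ^ (2 * m + 1) = 2 ^ (2 * m) + (2 ^ m * 2 ^ m + 0) := by ring
  have hω : (cell m ω).testBit ∈ F ↔ ω ∈ F :=
    ⟨hF _ _ (cell_testBit_cell m ω), hF _ _ (cell_testBit_cell m ω).symm⟩
  rw [h, psum_betCoeff F u le_rfl (Nat.zero_le _) (Or.inr rfl), if_pos (cell_lt m ω)]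
  by_cases hm : ω ∈ F
  · simp [hω.2 hm, hm, mul_comm]
  · simp [mt hω.1 hm, hm]

/-- Up to the end of the block, a partial sum consists of a part of the final sum and of one
incomplete Dirichlet kernel, centred at some point of `F`. -/
lemma psum_betCoeff_cases (F : Set (ℕ → Bool)) (m : ℕ) (u : ℝ) (M : ℕ) :
    ∃ q r : ℕ, r ≤ 2 ^ m ∧ ∀ ω, |psum (betCoeff F m u) M ω| ≤
      |F.indicator (fun _ => u) (cell m ω).testBit| +
        |F.indicator (fun _ => u / 2 ^ m) q.testBit| *
          |∑ j ∈ Finset.range r, cwalsh j q.testBit * cwalsh j ω| := by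
  have main : ∀ q r : ℕ, q ≤ 2 ^ m → r ≤ 2 ^ m → (q < 2 ^ m ∨ r = 0) → ∀ ω,
      |psum (betCoeff F m u) (2 ^ (2 * m) + (2 ^ m * q + r)) ω| ≤
      |F.indicator (fun _ => u) (cell m ω).testBit| +
        |F.indicator (fun _ => u / 2 ^ m) q.testBit| *
          |∑ j ∈ Finset.range r, cwalsh j q.testBit * cwalsh j ω| := by
    intro q r hq hr hqr ω
    rw [psum_betCoeff F u hq hr hqr]
    refine (abs_add_le _ _).trans (add_le_add ?_ ?_)
    · split_ifs
      · rw [abs_mul, betSign, abs_cwalsh, one_mul]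
      · simp
    · rw [abs_mul, abs_mul, abs_cwalsh, one_mul]
  rcases lt_or_ge M (2 ^ (2 * m)) with hM | hM
  · refine ⟨0, 0, Nat.zero_le _, fun ω => ?_⟩
    rw [psum_eq_zero fun k hk => betCoeff_eq_zero_of_lt (hk.trans hM), abs_zero]
    positivity
  rcases lt_or_ge M (2 ^ (2 * m + 1)) with hM' | hM'
  · obtain ⟨T, rfl⟩ := Nat.exists_eq_add_of_le hM
    have hT : T < 2 ^ m * 2 ^ m := by
      have : 2 ^ (2 * m + 1) = 2 ^ (2 * m) + 2 ^ m * 2 ^ m := by ring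
      omega
    have hq : T / 2 ^ m < 2 ^ m := Nat.div_lt_of_lt_mul hT
    have hr := (Nat.mod_lt T (Nat.two_pow_pos m)).le
    refine ⟨T / 2 ^ m, T % 2 ^ m, hr, fun ω => ?_⟩
    have := main _ _ hq.le hr (Or.inl hq) ω
    rwa [Nat.div_add_mod] at this
  · refine ⟨2 ^ m, 0, Nat.zero_le _, fun ω => ?_⟩
    rw [psum_eq_of_le (fun k hk => betCoeff_eq_zero_of_le hk) hM',
      show 2 ^ (2 * m + 1) = 2 ^ (2 * m) + (2 ^ m * 2 ^ m + 0) by ring]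
    exact main _ _ le_rfl (Nat.zero_le _) (Or.inr rfl) ω

lemma abs_psum_betCoeff_le (F : Set (ℕ → Bool)) (m : ℕ) (u : ℝ) (M : ℕ) (ω : ℕ → Bool) :
    |psum (betCoeff F m u) M ω| ≤ 2 * |u| := by
  classical
  obtain ⟨q, r, hr, h⟩ := psum_betCoeff_cases F m u M
  refine (h ω).trans ?_
  have h1 : |F.indicator (fun _ => u) (cell m ω).testBit| ≤ |u| := by
    rw [Set.indicator_apply]; split_ifs <;> simp
  have h2 : |F.indicator (fun _ => u / 2 ^ m) q.testBit| ≤ |u| / 2 ^ m := by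
    rw [Set.indicator_apply]
    split_ifs
    · rw [abs_div, abs_of_pos (by positivity : (0 : ℝ) < 2 ^ m)]
    · simp; positivity
  have h3 : |∑ j ∈ Finset.range r, cwalsh j q.testBit * cwalsh j ω| ≤ 2 ^ m := by
    refine (Finset.abs_sum_le_sum_abs _ _).trans ?_
    simp only [abs_mul, abs_cwalsh, mul_one, Finset.sum_const, Finset.card_range, nsmul_eq_mul]
    exact_mod_cast hr
  calc _ ≤ |u| + |u| / 2 ^ m * 2 ^ m := by gcongr
    _ = 2 * |u| := by field_simp; norm_num

lemma abs_psum_betCoeff_le_of_notMem {F : Set (ℕ → Bool)} {m ρ c : ℕ} (hρ : ρ ≤ m)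
    (hF : ∀ ω ∈ F, cell ρ ω = c) (u : ℝ) (M : ℕ) {ω : ℕ → Bool} (hω : cell ρ ω ≠ c) :
    |psum (betCoeff F m u) M ω| ≤ |u| / 2 ^ m * 2 ^ ρ := by
  obtain ⟨q, r, hr, h⟩ := psum_betCoeff_cases F m u M
  refine (h ω).trans ?_
  have h1 : (cell m ω).testBit ∉ F := fun hm =>
    hω ((cell_mono hρ (cell_testBit_cell m ω)).symm.trans (hF _ hm))
  rw [Set.indicator_of_notMem h1, abs_zero, zero_add]
  by_cases hq : q.testBit ∈ F
  · rw [Set.indicator_of_mem hq, abs_div, abs_of_pos (by positivity : (0 : ℝ) < 2 ^ m)]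
    gcongr
    refine abs_sum_cwalsh_mul_le (fun h' => hω ?_) r
    rw [← hF _ hq, cell_eq_iff.2 h']
  · rw [Set.indicator_of_notMem hq, abs_zero, zero_mul]
    positivity

lemma betSign_eq_one_or (m : ℕ) (ω : ℕ → Bool) : betSign m ω = 1 ∨ betSign m ω = -1 :=
  cwalsh_eq_one_or _ _

lemma betSign_congr {m : ℕ} {ω ω' : ℕ → Bool} (h : cell (2 * m + 1) ω = cell (2 * m + 1) ω') :
    betSign m ω = betSign m ω' := by
  rw [betSign, betSign, cell_mono (by omega) h]
  refine cwalsh_congr ?_ (cell_eq_iff.1 h)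
  have := Nat.mul_lt_mul_of_pos_left (cell_lt m ω') (Nat.two_pow_pos m)
  calc _ < 2 ^ (2 * m) + 2 ^ m * 2 ^ m := by omega
    _ = 2 ^ (2 * m + 1) := by ring

/-! ### Blocks of coefficients with nonincreasing absolute values -/

/-- The coefficient sequence `a` lives on `[2 ^ L, 2 ^ R)`, its nonzero terms are nonincreasing in
absolute value and at most `τ`, and it decays like a power of the index. -/
structure IsBlock (a : ℕ → ℝ) (L R : ℕ) (τ : ℝ) : Prop where
  supp : ∀ k, a k ≠ 0 → 2 ^ L ≤ k ∧ k < 2 ^ R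
  anti : ∀ k l, k < l → a k ≠ 0 → |a l| ≤ |a k|
  le : ∀ k, |a k| ≤ τ
  decay : ∀ k, |a k| ≤ (3 / 4) ^ Nat.log 2 k

namespace IsBlock

variable {a a' : ℕ → ℝ} {L R R' : ℕ} {τ τ' : ℝ}

lemma eq_zero_of_lt (h : IsBlock a L R τ) {k : ℕ} (hk : k < 2 ^ L) : a k = 0 := by
  by_contra hne
  exact absurd (h.supp k hne).1 (not_le.2 hk)

lemma eq_zero_of_le (h : IsBlock a L R τ) {k : ℕ} (hk : 2 ^ R ≤ k) : a k = 0 := by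
  by_contra hne
  exact absurd (h.supp k hne).2 (not_lt.2 hk)

lemma zero (L R : ℕ) (hτ : 0 ≤ τ) : IsBlock 0 L R τ where
  supp k hk := absurd rfl hk
  anti k l _ hk := absurd rfl hk
  le k := by simpa using hτ
  decay k := by simp; positivity

lemma psum_of_le (h : IsBlock a L R τ) {M : ℕ} (hM : M ≤ 2 ^ L) (ω : ℕ → Bool) :
    psum a M ω = 0 := psum_eq_zero (fun _ hk => h.eq_zero_of_lt (hk.trans_le hM)) ω

lemma psum_of_ge (h : IsBlock a L R τ) {M : ℕ} (hM : 2 ^ R ≤ M) (ω : ℕ → Bool) :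
    psum a M ω = psum a (2 ^ R) ω := psum_eq_of_le (fun _ hk => h.eq_zero_of_le hk) hM ω

lemma exists_lower_bound (h : IsBlock a L R τ) :
    ∃ σ : ℝ, 0 < σ ∧ ∀ k, a k ≠ 0 → σ ≤ |a k| := by
  have hfin : {k | a k ≠ 0}.Finite := (Set.finite_lt_nat (2 ^ R)).subset fun k hk => (h.supp k hk).2
  rcases {k | a k ≠ 0}.eq_empty_or_nonempty with he | hne
  · exact ⟨1, one_pos, fun k hk => absurd (show k ∈ {k | a k ≠ 0} from hk) (by simp [he])⟩
  · obtain ⟨k₀, hk₀, hmin⟩ := hfin.exists_minimalFor (fun k => |a k|) _ hne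
    exact ⟨|a k₀|, abs_pos.2 hk₀, fun k hk => (le_total |a k₀| |a k|).elim id fun h' => hmin hk h'⟩

lemma add (h : IsBlock a L R τ) (h' : IsBlock a' R R' τ') (hLR : L ≤ R) (hRR : R ≤ R')
    (hτ : τ' ≤ τ) (hlow : ∀ k, a k ≠ 0 → τ' ≤ |a k|) : IsBlock (a + a') L R' τ := by
  have hcases : ∀ k, (a + a') k = a k ∧ a' k = 0 ∨ (a + a') k = a' k ∧ a k = 0 := by
    intro k
    rcases lt_or_ge k (2 ^ R) with hk | hk
    · left; simp [h'.eq_zero_of_lt hk]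
    · right; simp [h.eq_zero_of_le hk]
  constructor
  · intro k hk
    rcases hcases k with ⟨he, -⟩ | ⟨he, -⟩ <;> rw [he] at hk
    · exact ⟨(h.supp k hk).1, (h.supp k hk).2.trans_le (Nat.pow_le_pow_right two_pos hRR)⟩
    · exact ⟨(Nat.pow_le_pow_right two_pos hLR).trans (h'.supp k hk).1, (h'.supp k hk).2⟩
  · intro k l hkl hk
    rcases hcases k with ⟨he, -⟩ | ⟨he, -⟩ <;> rw [he] at hk ⊢
    · rcases hcases l with ⟨hl, -⟩ | ⟨hl, -⟩ <;> rw [hl]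
      · exact h.anti k l hkl hk
      · exact (h'.le l).trans (hlow k hk)
    · have hl : a l = 0 := h.eq_zero_of_le ((h'.supp k hk).1.trans hkl.le)
      rw [Pi.add_apply, hl, zero_add]
      exact h'.anti k l hkl hk
  · intro k
    rcases hcases k with ⟨he, -⟩ | ⟨he, -⟩ <;> rw [he]
    · exact h.le k
    · exact (h'.le k).trans hτ
  · intro k
    rcases hcases k with ⟨he, -⟩ | ⟨he, -⟩ <;> rw [he]
    · exact h.decay k
    · exact h'.decay k

/-- Partial sums of a concatenation are either partial sums of the first block or partial sums of
the second block added to the complete first block. -/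
lemma psum_add_cases (h : IsBlock a L R τ) (h' : IsBlock a' R R' τ') (M : ℕ) :
    (∀ ω, psum (a + a') M ω = psum a M ω) ∨
      ∀ ω, psum (a + a') M ω = psum a (2 ^ R) ω + psum a' M ω := by
  rcases le_total M (2 ^ R) with hM | hM
  · left; intro ω; rw [psum_add, h'.psum_of_le hM, add_zero]
  · right; intro ω; rw [psum_add, h.psum_of_ge hM]

lemma psum_add_full (h : IsBlock a L R τ) (hRR : R ≤ R') (ω : ℕ → Bool) :
    psum (a + a') (2 ^ R') ω = psum a (2 ^ R) ω + psum a' (2 ^ R') ω := by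
  rw [psum_add, h.psum_of_ge (Nat.pow_le_pow_right two_pos hRR)]

end IsBlock

lemma isBlock_betCoeff {F : Set (ℕ → Bool)} {m L : ℕ} {u τ : ℝ} (hL : L ≤ 2 * m)
    (hτ : |u| / 2 ^ m ≤ τ) (hdecay : |u| / 2 ^ m ≤ (3 / 4) ^ (2 * m)) :
    IsBlock (betCoeff F m u) L (2 * m + 1) τ := by
  have hle : ∀ k, |betCoeff F m u k| ≤ |u| / 2 ^ m := by
    intro k
    by_cases hk : betCoeff F m u k = 0
    · rw [hk, abs_zero]; positivity
    · exact (abs_betCoeff_of_ne hk).le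
  have hsupp : ∀ k, betCoeff F m u k ≠ 0 → 2 ^ (2 * m) ≤ k ∧ k < 2 ^ (2 * m + 1) := by
    intro k hk
    by_contra h
    exact hk (if_neg h)
  refine ⟨fun k hk => ?_, fun k l _ hk => ?_, fun k => (hle k).trans hτ, fun k => ?_⟩
  · exact ⟨(Nat.pow_le_pow_right two_pos hL).trans (hsupp k hk).1, (hsupp k hk).2⟩
  · exact (hle l).trans (abs_betCoeff_of_ne hk).ge
  · by_cases hk : betCoeff F m u k = 0
    · rw [hk, abs_zero]; positivity
    · rw [Nat.log_eq_of_pow_le_of_lt_pow (hsupp k hk).1 (hsupp k hk).2]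
      exact (hle k).trans hdecay

lemma eventually_bet_small (u ρ : ℝ) {τ η : ℝ} (hτ : 0 < τ) (hη : 0 < η) :
    ∀ᶠ m : ℕ in atTop, |u| / 2 ^ m ≤ τ ∧ |u| / 2 ^ m ≤ (3 / 4) ^ (2 * m) ∧
      |u| / 2 ^ m * ρ ≤ η := by
  have h1 : Tendsto (fun m : ℕ => |u| / 2 ^ m) atTop (𝓝 0) := by
    have := (tendsto_pow_atTop_nhds_zero_of_lt_one (r := (1 / 2 : ℝ)) (by norm_num)
      (by norm_num)).const_mul |u|
    simpa [div_eq_mul_inv] using this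
  have h2 : Tendsto (fun m : ℕ => |u| * (8 / 9) ^ m) atTop (𝓝 0) := by
    simpa using (tendsto_pow_atTop_nhds_zero_of_lt_one (r := (8 / 9 : ℝ)) (by norm_num)
      (by norm_num)).const_mul |u|
  have h3 : Tendsto (fun m : ℕ => |u| / 2 ^ m * ρ) atTop (𝓝 0) := by simpa using h1.mul_const ρ
  filter_upwards [h1.eventually_le_const hτ, h2.eventually_le_const one_pos,
    h3.eventually_le_const hη] with m hm1 hm2 hm3
  refine ⟨hm1, ?_, hm3⟩
  have h4 : (8 / 9 : ℝ) ^ m * ((3 / 4) ^ (2 * m) * 2 ^ m) = 1 := by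
    rw [pow_mul, ← mul_pow, ← mul_pow]; norm_num
  rw [div_le_iff₀ (by positivity)]
  calc |u| = |u| * (8 / 9) ^ m * ((3 / 4) ^ (2 * m) * 2 ^ m) := by rw [mul_assoc, h4, mul_one]
    _ ≤ 1 * ((3 / 4) ^ (2 * m) * 2 ^ m) := by gcongr
    _ = _ := one_mul _

/-- Doubling the stake after each loss, at most `k` times: the bettor wins `u` on `F` except on
the set `B` where all `k` bets are lost. -/
lemma exists_block_of_subset_cell (k : ℕ) : ∀ (F : Set (ℕ → Bool)) (m ρ c : ℕ) (u : ℝ) (L : ℕ)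
    (τ η : ℝ), IsLevel m F → (∀ ω ∈ F, cell ρ ω = c) → 0 < τ → 0 < η →
    ∃ (a : ℕ → ℝ) (R : ℕ) (B : Set (ℕ → Bool)), L ≤ R ∧ IsBlock a L R τ ∧ IsLevel R B ∧ B ⊆ F ∧
      (∀ ω, psum a (2 ^ R) ω = u * (F.indicator 1 ω - 2 ^ k * B.indicator 1 ω)) ∧
      (∀ M ω, |psum a M ω| ≤ (2 ^ (k + 1) - 1) * |u|) ∧
      ∀ M ω, cell ρ ω ≠ c → |psum a M ω| ≤ η := by
  induction k with
  | zero =>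
    intro F m ρ c u L τ η hF hFc hτ hη
    have h0 : ∀ M ω, psum 0 M ω = 0 := fun M ω => psum_eq_zero (fun _ _ => rfl) ω
    refine ⟨0, max L m, F, le_max_left _ _, IsBlock.zero _ _ hτ.le, hF.mono (le_max_right _ _),
      subset_rfl, fun ω => by simp [h0], fun M ω => ?_, fun M ω _ => by simpa [h0] using hη.le⟩
    rw [h0, abs_zero]
    norm_num
  | succ k ih =>
    intro F m₀ ρ c u L τ η hF₀ hFc hτ hη
    obtain ⟨m, ⟨hmτ, hmd, hmη⟩, hm⟩ :=
      ((eventually_bet_small u (2 ^ ρ) hτ hη).and (eventually_ge_atTop (m₀ + ρ + L))).exists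
    have hF : IsLevel m F := hF₀.mono (by omega)
    have ha := isBlock_betCoeff (F := F) (L := L) (by omega) hmτ hmd
    obtain ⟨σ, hσ, hlow⟩ := ha.exists_lower_bound
    -- The points of `F` where the first bet is lost.
    set F' : Set (ℕ → Bool) := F ∩ {ω | betSign m ω = -1}
    have hF'l : IsLevel (2 * m + 1) F' := by
      rintro ω ω' h ⟨h1, h2⟩
      exact ⟨hF.mono (by omega) ω ω' h h1, (betSign_congr h).symm.trans h2⟩
    obtain ⟨a', R, B, hR, ha', hB, hBF, hfull, hbd, hoff⟩ :=
      ih F' (2 * m + 1) ρ c (2 * u) (2 * m + 1) (min τ σ) η hF'l (fun ω hω => hFc ω hω.1)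
        (lt_min hτ hσ) hη
    refine ⟨betCoeff F m u + a', R, B, by omega, ha.add ha' (by omega) hR (min_le_left _ _)
      fun k hk => (min_le_right _ _).trans (hlow k hk), hB, hBF.trans inter_subset_left,
      fun ω => ?_, fun M ω => ?_, fun M ω hω => ?_⟩
    · rw [ha.psum_add_full hR, psum_betCoeff_full hF, hfull]
      have hsplit : betSign m ω * F.indicator 1 ω =
          F.indicator 1 ω - 2 * F'.indicator (1 : (ℕ → Bool) → ℝ) ω := by
        by_cases hω : ω ∈ F
        · rcases betSign_eq_one_or m ω with h | h
          · have : ω ∉ F' := fun h' => by have := h'.2; simp only [mem_ofPred_eq] at this; linarith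
            simp [h, hω, this]
          · have : ω ∈ F' := ⟨hω, h⟩
            simp only [h, hω, this, indicator_of_mem, Pi.one_apply]; norm_num
        · have : ω ∉ F' := fun h' => hω h'.1
          simp [hω, this]
      rw [mul_assoc, hsplit, pow_succ]
      ring
    · have h2k : (1 : ℝ) ≤ 2 ^ k := one_le_pow₀ one_le_two
      have hu := abs_nonneg u
      rcases ha.psum_add_cases ha' M with h | h <;> rw [h]
      · refine (abs_psum_betCoeff_le F m u M ω).trans ?_
        rw [pow_succ, pow_succ]
        nlinarith
      · have h1 : |psum (betCoeff F m u) (2 ^ (2 * m + 1)) ω| ≤ |u| := by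
          rw [psum_betCoeff_full hF, abs_mul, abs_mul, betSign, abs_cwalsh, mul_one]
          by_cases hω : ω ∈ F <;> simp [hω]
        have h2 := hbd M ω
        rw [abs_mul, abs_two] at h2
        refine (abs_add_le _ _).trans ((add_le_add h1 h2).trans (le_of_eq ?_))
        rw [pow_succ 2 (k + 1)]
        ring
    · have hωF : ω ∉ F := fun h => hω (hFc ω h)
      rcases ha.psum_add_cases ha' M with h | h <;> rw [h]
      · exact (abs_psum_betCoeff_le_of_notMem (by omega) hFc u M hω).trans hmη
      · rw [psum_betCoeff_full hF, indicator_of_notMem hωF, mul_zero, zero_add]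
        exact hoff M ω hω

/-! ### Walsh functions on the unit interval and the coin-tossing measure -/

/-- Binary digits of `x`, read off from the signs of the Rademacher functions. At dyadic points,
which form a null set, the value is a convention. -/
noncomputable def digits (x : ℝ) (k : ℕ) : Bool := decide (rademacher (k + 1) x < 0)

lemma measurable_rademacher (n : ℕ) : Measurable (rademacher n) := by
  have h : Measurable Real.sign := by
    unfold Real.sign
    exact Measurable.ite measurableSet_Iio measurable_const
      (Measurable.ite measurableSet_Ioi measurable_const measurable_const)
  exact h.comp (by fun_prop)

lemma measurable_walsh (n : ℕ) : Measurable (walsh n) :=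
  Finset.measurable_prod _ fun _ _ => measurable_rademacher _

lemma measurable_digits : Measurable digits := by
  refine measurable_pi_lambda _ fun k => measurable_to_bool ?_
  have : (fun x => digits x k) ⁻¹' {true} = {x | rademacher (k + 1) x < 0} := by
    ext x; simp [digits]
  rw [this]
  exact measurableSet_lt (measurable_rademacher _) measurable_const

/-- `x` is not a zero of any Rademacher function, i.e. not a dyadic rational. -/
def NonDyadic (x : ℝ) : Prop := ∀ k : ℕ, Real.sin (2 ^ (k + 1) * Real.pi * x) ≠ 0

lemma ae_nonDyadic : ∀ᵐ x : ℝ, NonDyadic x := by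
  rw [show (∀ᵐ x : ℝ, NonDyadic x) ↔ ∀ k : ℕ, ∀ᵐ x : ℝ,
    Real.sin (2 ^ (k + 1) * Real.pi * x) ≠ 0 from ae_all_iff]
  intro k
  have hc : {x : ℝ | Real.sin (2 ^ (k + 1) * Real.pi * x) = 0}.Countable := by
    refine (countable_range fun n : ℤ => (n : ℝ) / 2 ^ (k + 1)).mono fun x hx => ?_
    obtain ⟨n, hn⟩ := Real.sin_eq_zero_iff.1 hx
    refine ⟨n, ?_⟩
    have hπ := Real.pi_pos.ne'
    have : (n : ℝ) = 2 ^ (k + 1) * x := by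
      apply mul_right_cancel₀ hπ; rw [hn]; ring
    simp only [this]
    field_simp
  exact (compl_mem_ae_iff (s := {x : ℝ | Real.sin (2 ^ (k + 1) * Real.pi * x) = 0})).2
    (hc.measure_zero volume)

lemma rademacher_eq {x : ℝ} (hx : NonDyadic x) (k : ℕ) :
    rademacher (k + 1) x = if digits x k then -1 else 1 := by
  unfold digits rademacher
  rcases lt_or_gt_of_ne (hx k) with h | h
  · rw [Real.sign_of_neg h]; norm_num
  · rw [Real.sign_of_pos h]; norm_num

lemma walsh_eq_cwalsh {x : ℝ} (hx : NonDyadic x) (n : ℕ) : walsh n x = cwalsh n (digits x) := by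
  rw [walsh, cwalsh, Finset.prod_filter]
  refine Finset.prod_congr rfl fun k _ => ?_
  rw [rademacher_eq hx]
  cases n.testBit k <;> simp

lemma rademacher_add_of_lt {k l : ℕ} (h : k < l) (x : ℝ) :
    rademacher (l + 1) (x + 1 / 2 ^ (k + 1)) = rademacher (l + 1) x := by
  obtain ⟨d, rfl⟩ := Nat.exists_eq_add_of_lt h
  unfold rademacher
  rw [show (2 : ℝ) ^ (k + d + 1 + 1) * Real.pi * (x + 1 / 2 ^ (k + 1)) =
      2 ^ (k + d + 1 + 1) * Real.pi * x + ((2 ^ d : ℕ) : ℝ) * (2 * Real.pi) by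
    rw [show (2 : ℝ) ^ (k + d + 1 + 1) = 2 ^ (k + 1) * 2 ^ d * 2 by ring]; push_cast; field_simp,
    Real.sin_add_nat_mul_two_pi]

lemma rademacher_add_self (k : ℕ) (x : ℝ) :
    rademacher (k + 1) (x + 1 / 2 ^ (k + 1)) = -rademacher (k + 1) x := by
  unfold rademacher
  rw [show (2 : ℝ) ^ (k + 1) * Real.pi * (x + 1 / 2 ^ (k + 1)) =
      2 ^ (k + 1) * Real.pi * x + Real.pi by field_simp, Real.sin_add_pi, Real.sign_neg]

lemma walsh_periodic (n : ℕ) : Function.Periodic (walsh n) 1 := by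
  intro x
  unfold walsh
  refine Finset.prod_congr rfl fun k _ => ?_
  unfold rademacher
  rw [show (2 : ℝ) ^ (k + 1) * Real.pi * (x + 1) =
      2 ^ (k + 1) * Real.pi * x + ((2 ^ k : ℕ) : ℝ) * (2 * Real.pi) by push_cast; ring,
    Real.sin_add_nat_mul_two_pi]

/-- The translation by half the period of the slowest Rademacher factor changes the sign of a
nonconstant Walsh function. -/
lemma integral_walsh {n : ℕ} (hn : n ≠ 0) : ∫ x in Icc (0 : ℝ) 1, walsh n x = 0 := by
  have hex : ∃ k, n.testBit k = true := by
    by_contra h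
    push Not at h
    exact hn (Nat.eq_of_testBit_eq fun i => by simpa using h i)
  classical
  set k := Nat.find hex
  have hkn : n.testBit k = true := Nat.find_spec hex
  have hlow : ∀ l < k, n.testBit l = false := fun l hl => by simpa using Nat.find_min hex hl
  have hklt : k < n := by
    by_contra h
    rw [Nat.testBit_lt_two_pow ((Nat.lt_two_pow_self (n := n)).trans_le
      (Nat.pow_le_pow_right two_pos (not_lt.1 h)))] at hkn
    exact absurd hkn (by simp)
  have hmem : k ∈ (Finset.range n).filter fun k => n.testBit k = true := by simp [hklt, hkn]
  have hflip : ∀ x, walsh n (x + 1 / 2 ^ (k + 1)) = -walsh n x := by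
    intro x
    unfold walsh
    rw [← Finset.mul_prod_erase _ _ hmem, ← Finset.mul_prod_erase _ _ hmem, rademacher_add_self,
      neg_mul]
    congr 2
    refine Finset.prod_congr rfl fun l hl => rademacher_add_of_lt ?_ x
    simp only [Finset.mem_erase, Finset.mem_filter] at hl
    by_contra h
    rcases (not_lt.1 h).lt_or_eq with h' | h'
    · rw [hlow l h'] at hl; exact absurd hl.2.2 (by simp)
    · exact hl.1 h'
  rw [integral_Icc_eq_integral_Ioc, ← intervalIntegral.integral_of_le zero_le_one]
  have h1 := (walsh_periodic n).intervalIntegral_add_eq 0 (1 / 2 ^ (k + 1))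
  have h2 := intervalIntegral.integral_comp_add_right (a := 0) (b := 1) (walsh n)
    (1 / 2 ^ (k + 1) : ℝ)
  simp only [hflip, intervalIntegral.integral_neg, zero_add] at h1 h2
  rw [add_comm (1 / 2 ^ (k + 1) : ℝ) 1, ← h2] at h1
  linarith

/-- Lebesgue measure on `[0, 1]`. -/
noncomputable abbrev unitMeasure : Measure ℝ := volume.restrict (Icc (0 : ℝ) 1)

instance : IsProbabilityMeasure unitMeasure := ⟨by simp [unitMeasure]⟩

/-- The distribution of the binary digits of a random point of `[0, 1]`. -/
noncomputable def coin : Measure (ℕ → Bool) := unitMeasure.map digits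

instance : IsProbabilityMeasure coin :=
  Measure.isProbabilityMeasure_map measurable_digits.aemeasurable

lemma ae_unit_nonDyadic : ∀ᵐ x ∂unitMeasure, NonDyadic x := ae_restrict_of_ae ae_nonDyadic

lemma integrable_cwalsh (n : ℕ) : Integrable (cwalsh n) coin :=
  Integrable.of_bound (measurable_cwalsh n).aestronglyMeasurable 1
    (Eventually.of_forall fun ω => by simp)

lemma integral_cwalsh {n : ℕ} (hn : n ≠ 0) : ∫ ω, cwalsh n ω ∂coin = 0 := by
  rw [coin, integral_map measurable_digits.aemeasurable (measurable_cwalsh n).aestronglyMeasurable,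
    ← integral_walsh hn]
  refine integral_congr_ae ?_
  filter_upwards [ae_unit_nonDyadic] with x hx
  rw [walsh_eq_cwalsh hx]

lemma integral_psum {a : ℕ → ℝ} (h0 : a 0 = 0) (M : ℕ) : ∫ ω, psum a M ω ∂coin = 0 := by
  unfold psum
  rw [integral_finsetSum _ fun k _ => (integrable_cwalsh k).const_mul _]
  refine Finset.sum_eq_zero fun k _ => ?_
  rw [integral_const_mul]
  rcases eq_or_ne k 0 with rfl | hk
  · rw [h0, zero_mul]
  · rw [integral_cwalsh hk, mul_zero]

lemma coin_cell {m i : ℕ} (hi : i < 2 ^ m) : coin.real {ω | cell m ω = i} = 1 / 2 ^ m := by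
  have h1 : ∀ ω, ∑ j ∈ Finset.range (2 ^ m), cwalsh j i.testBit * cwalsh j ω =
      2 ^ m * {ω | cell m ω = i}.indicator (1 : (ℕ → Bool) → ℝ) ω := by
    intro ω
    by_cases h : cell m ω = i
    · rw [indicator_of_mem (show ω ∈ {ω | cell m ω = i} from h), Pi.one_apply, mul_one]
      exact sum_cwalsh_mul_of_agree fun k hk => by rw [← h, testBit_cell hk]
    · rw [indicator_of_notMem (show ω ∉ {ω | cell m ω = i} from h), mul_zero]
      refine sum_cwalsh_mul_of_not_agree fun h' => h ?_
      rw [← cell_testBit hi]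
      exact (cell_eq_iff.2 h').symm
  have h2 : ∫ ω, ∑ j ∈ Finset.range (2 ^ m), cwalsh j i.testBit * cwalsh j ω ∂coin = 1 := by
    rw [integral_finsetSum _ fun k _ => (integrable_cwalsh k).const_mul _,
      Finset.sum_eq_single 0]
    · simp
    · intro j _ hj
      rw [integral_const_mul, integral_cwalsh hj, mul_zero]
    · intro h; simp at h
  simp_rw [h1] at h2
  rw [integral_const_mul, integral_indicator_one (isLevel_cell m i).measurableSet] at h2
  field_simp
  linarith

/-! ### Approximation of step functions by blocks -/

lemma coin_lost {F B : Set (ℕ → Bool)} {a : ℕ → ℝ} {u : ℝ} {k M : ℕ} (hF : MeasurableSet F)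
    (hB : MeasurableSet B) (h0 : a 0 = 0) (hu : u ≠ 0)
    (h : ∀ ω, psum a M ω = u * (F.indicator 1 ω - 2 ^ k * B.indicator 1 ω)) :
    coin.real B = coin.real F / 2 ^ k := by
  have h1 := integral_psum h0 M
  simp_rw [h] at h1
  have hFi : Integrable (F.indicator (1 : (ℕ → Bool) → ℝ)) coin :=
    (integrable_const (1 : ℝ)).indicator hF
  have hBi : Integrable (B.indicator (1 : (ℕ → Bool) → ℝ)) coin :=
    (integrable_const (1 : ℝ)).indicator hB
  rw [integral_const_mul, integral_sub hFi (hBi.const_mul _), integral_const_mul,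
    integral_indicator_one hF, integral_indicator_one hB] at h1
  rcases mul_eq_zero.1 h1 with h2 | h2
  · exact absurd h2 hu
  · field_simp
    linarith

lemma exists_block_cell (k ρ i : ℕ) (hi : i < 2 ^ ρ) (u : ℝ) (L : ℕ) {τ η : ℝ} (hτ : 0 < τ)
    (hη : 0 < η) :
    ∃ (a : ℕ → ℝ) (R : ℕ) (B : Set (ℕ → Bool)), L ≤ R ∧ IsBlock a L R τ ∧ MeasurableSet B ∧
      B ⊆ {ω | cell ρ ω = i} ∧ coin.real B ≤ 1 / 2 ^ ρ / 2 ^ k ∧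
      (∀ ω, psum a (2 ^ R) ω =
        u * ({ω | cell ρ ω = i}.indicator 1 ω - 2 ^ k * B.indicator 1 ω)) ∧
      (∀ M ω, |psum a M ω| ≤ (2 ^ (k + 1) - 1) * |u|) ∧
      ∀ M ω, cell ρ ω ≠ i → |psum a M ω| ≤ η := by
  rcases eq_or_ne u 0 with rfl | hu
  · have h0 : ∀ M ω, psum 0 M ω = 0 := fun M ω => psum_eq_zero (fun _ _ => rfl) ω
    exact ⟨0, L, ∅, le_rfl, IsBlock.zero _ _ hτ.le, MeasurableSet.empty, empty_subset _,
      by rw [measureReal_empty]; positivity, by simp [h0], by simp [h0],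
      fun M ω _ => by simpa [h0] using hη.le⟩
  · obtain ⟨a, R, B, hR, ha, hB, hBF, hfull, hbd, hoff⟩ :=
      exists_block_of_subset_cell k _ ρ ρ i u L τ η (isLevel_cell ρ i) (fun ω hω => hω) hτ hη
    refine ⟨a, R, B, hR, ha, hB.measurableSet, hBF, ?_, hfull, hbd, hoff⟩
    rw [coin_lost (isLevel_cell ρ i).measurableSet hB.measurableSet
      (ha.eq_zero_of_lt (Nat.two_pow_pos L)) hu hfull, coin_cell hi]

/-- The cylinders of level `ρ` are treated one after another. At any moment only one of them,
the cylinder number `j`, carries a partial sum that is not under control. -/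
lemma exists_block_cells {v : (ℕ → Bool) → ℝ} {r ρ : ℕ} {V : ℝ}
    (hv : ∀ ω ω', cell r ω = cell r ω' → v ω = v ω') (hV : ∀ ω, |v ω| ≤ V) (k : ℕ) (hρ : r ≤ ρ)
    (L : ℕ) {τ η : ℝ} (hτ : 0 < τ) (hη : 0 < η) (hη1 : η ≤ 1) (i : ℕ) (hi : i ≤ 2 ^ ρ) :
    ∃ (a : ℕ → ℝ) (R : ℕ) (B : Set (ℕ → Bool)), L ≤ R ∧ IsBlock a L R τ ∧ MeasurableSet B ∧
      B ⊆ {ω | cell ρ ω < i} ∧ coin.real B ≤ i / 2 ^ ρ / 2 ^ k ∧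
      (∀ ω, psum a (2 ^ R) ω =
        if cell ρ ω < i then v ω * (1 - 2 ^ k * B.indicator 1 ω) else 0) ∧
      ∀ M, ∃ j < 2 ^ ρ, ∀ ω, |psum a M ω| ≤ 2 ^ (k + 1) * V + 1 ∧
        (cell ρ ω ≠ j → ω ∉ B → |psum a M ω| ≤ |v ω| + η) := by
  have hV0 : 0 ≤ V := (abs_nonneg _).trans (hV fun _ => false)
  have h2k : (1 : ℝ) ≤ 2 ^ k := one_le_pow₀ one_le_two
  induction i with
  | zero =>
    have h0 : ∀ M ω, psum 0 M ω = 0 := fun M ω => psum_eq_zero (fun _ _ => rfl) ω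
    refine ⟨0, L, ∅, le_rfl, IsBlock.zero _ _ hτ.le, MeasurableSet.empty, empty_subset _,
      by simp, by simp [h0], fun M => ⟨0, Nat.two_pow_pos ρ, fun ω => ?_⟩⟩
    rw [h0, abs_zero]
    exact ⟨by positivity, fun _ _ => by positivity⟩
  | succ i ih =>
    obtain ⟨a, R, B, hR, ha, hB, hBF, hBm, hfull, hbd⟩ := ih (by omega)
    obtain ⟨σ, hσ, hlow⟩ := ha.exists_lower_bound
    obtain ⟨a', R', B', hR', ha', hB', hBF', hBm', hfull', hbd', hoff'⟩ :=
      exists_block_cell k ρ i hi (v i.testBit) R (lt_min hτ hσ) hη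
    have hvi : ∀ ω, cell ρ ω = i → v ω = v i.testBit := fun ω hω =>
      hv _ _ (cell_mono hρ (hω.trans (cell_testBit hi).symm))
    have hBi : ∀ ω, cell ρ ω = i → ω ∉ B := fun ω hω h => by
      have := hBF h
      simp only [mem_ofPred_eq] at this
      omega
    have hBi' : ∀ ω, cell ρ ω ≠ i → ω ∉ B' := fun ω hω h => hω (hBF' h)
    refine ⟨a + a', R', B ∪ B', hR.trans hR', ha.add ha' hR hR' (min_le_left _ _)
      fun k hk => (min_le_right _ _).trans (hlow k hk), hB.union hB', ?_, ?_, fun ω => ?_,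
      fun M => ?_⟩
    · rintro ω (h | h)
      · exact lt_trans (hBF h) (Nat.lt_succ_self i)
      · exact (show cell ρ ω = i from hBF' h) ▸ Nat.lt_succ_self _
    · refine (measureReal_union_le B B').trans ((add_le_add hBm hBm').trans (le_of_eq ?_))
      push_cast
      ring
    · rw [ha.psum_add_full hR', hfull, hfull']
      rcases eq_or_ne (cell ρ ω) i with h | h
      · have h1 : (B ∪ B').indicator (1 : (ℕ → Bool) → ℝ) ω = B'.indicator 1 ω := by
          by_cases hb : ω ∈ B' <;> simp [hb, hBi ω h]
        rw [h1, if_neg (by omega), if_pos (by omega), zero_add, hvi ω h,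
          indicator_of_mem (show ω ∈ {ω | cell ρ ω = i} from h), Pi.one_apply]
      · have h1 : (B ∪ B').indicator (1 : (ℕ → Bool) → ℝ) ω = B.indicator 1 ω := by
          by_cases hb : ω ∈ B <;> simp [hb, hBi' ω h]
        rw [h1, indicator_of_notMem (show ω ∉ {ω | cell ρ ω = i} from h),
          indicator_of_notMem (hBi' ω h)]
        by_cases hlt : cell ρ ω < i
        · rw [if_pos hlt, if_pos (by omega)]; ring
        · rw [if_neg hlt, if_neg (by omega)]; ring
    · rcases ha.psum_add_cases ha' M with h | h
      · obtain ⟨j, hj, hbd⟩ := hbd M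
        refine ⟨j, hj, fun ω => ?_⟩
        rw [h]
        exact ⟨(hbd ω).1, fun h1 h2 => (hbd ω).2 h1 fun h3 => h2 (Or.inl h3)⟩
      · refine ⟨i, hi, fun ω => ?_⟩
        rw [h, hfull]
        rcases eq_or_ne (cell ρ ω) i with hω | hω
        · rw [if_neg (by omega), zero_add]
          refine ⟨(hbd' M ω).trans ?_, fun h => absurd hω h⟩
          have : (2 ^ (k + 1) - 1) * |v i.testBit| ≤ (2 ^ (k + 1) - 1) * V := by
            refine mul_le_mul_of_nonneg_left (hV _) ?_
            rw [pow_succ]; linarith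
          linarith
        · have h1 := hoff' M ω hω
          constructor
          · have h2 : |if cell ρ ω < i then v ω * (1 - 2 ^ k * B.indicator 1 ω) else 0| ≤
                V * 2 ^ k := by
              split_ifs
              · rw [abs_mul]
                refine mul_le_mul (hV ω) ?_ (abs_nonneg _) hV0
                by_cases hb : ω ∈ B
                · rw [indicator_of_mem hb, Pi.one_apply, abs_le]
                  constructor <;> linarith
                · rw [indicator_of_notMem hb, mul_zero, sub_zero, abs_one]
                  exact h2k
              · rw [abs_zero]; positivity
            refine (abs_add_le _ _).trans ((add_le_add h2 h1).trans ?_)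
            rw [pow_succ]
            nlinarith
          · intro _ hb
            refine (abs_add_le _ _).trans (add_le_add ?_ h1)
            rw [indicator_of_notMem fun h3 => hb (Or.inl h3)]
            split_ifs
            · simp
            · simp

/-- A step function `v` agrees with a Walsh polynomial off a set `B` of measure at most
`2 ^ (-k)`. Off `B` and off a set `G` as small as desired, partial sums are dominated by `|v|`,
and the bound for them that holds everywhere does not depend on the smallness of `G`. -/
lemma exists_block {v : (ℕ → Bool) → ℝ} {r : ℕ} {V : ℝ}
    (hv : ∀ ω ω', cell r ω = cell r ω' → v ω = v ω') (hV : ∀ ω, |v ω| ≤ V) (k L : ℕ)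
    {τ η κ : ℝ} (hτ : 0 < τ) (hη : 0 < η) (hη1 : η ≤ 1) (hκ : 0 < κ) :
    ∃ (a : ℕ → ℝ) (R : ℕ) (B : Set (ℕ → Bool)), L ≤ R ∧ IsBlock a L R τ ∧ MeasurableSet B ∧
      coin.real B ≤ 1 / 2 ^ k ∧ (∀ ω ∉ B, psum a (2 ^ R) ω = v ω) ∧
      (∀ M ω, |psum a M ω| ≤ 2 ^ (k + 1) * V + 1) ∧
      ∀ M, ∃ G, MeasurableSet G ∧ coin.real G ≤ κ ∧
        ∀ ω, ω ∉ B → ω ∉ G → |psum a M ω| ≤ |v ω| + η := by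
  have hlim : Tendsto (fun ρ : ℕ => (1 : ℝ) / 2 ^ ρ) atTop (𝓝 0) := by
    simpa [one_div] using
      tendsto_pow_atTop_nhds_zero_of_lt_one (r := (2⁻¹ : ℝ)) (by norm_num) (by norm_num)
  obtain ⟨ρ, hρκ, hρ⟩ := ((hlim.eventually_le_const hκ).and (eventually_ge_atTop r)).exists
  obtain ⟨a, R, B, hR, ha, hB, -, hBm, hfull, hbd⟩ :=
    exists_block_cells hv hV k hρ L hτ hη hη1 (2 ^ ρ) le_rfl
  refine ⟨a, R, B, hR, ha, hB, ?_, fun ω hω => ?_, fun M ω => ?_, fun M => ?_⟩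
  · refine hBm.trans (le_of_eq ?_)
    push_cast
    field_simp
  · rw [hfull, if_pos (cell_lt ρ ω), indicator_of_notMem hω]
    ring
  · obtain ⟨j, -, h⟩ := hbd M
    exact (h ω).1
  · obtain ⟨j, hj, h⟩ := hbd M
    refine ⟨{ω | cell ρ ω = j}, (isLevel_cell ρ j).measurableSet, ?_, fun ω h1 h2 =>
      (h ω).2 h2 h1⟩
    rw [coin_cell hj]
    exact hρκ

/-- Infinitely many blocks in a row, the `s`-th one for the step function `v s`. -/
lemma exists_blocks {v : ℕ → (ℕ → Bool) → ℝ} {r : ℕ → ℕ} {V : ℕ → ℝ}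
    (hv : ∀ s ω ω', cell (r s) ω = cell (r s) ω' → v s ω = v s ω') (hV : ∀ s ω, |v s ω| ≤ V s)
    (k : ℕ → ℕ) {η κ : ℕ → ℝ} (hη : ∀ s, 0 < η s) (hη1 : ∀ s, η s ≤ 1) (hκ : ∀ s, 0 < κ s) :
    ∃ (a : ℕ → ℕ → ℝ) (L : ℕ → ℕ) (B : ℕ → Set (ℕ → Bool)), StrictMono L ∧
      (∀ s, IsBlock (a s) (L s) (L (s + 1)) 1) ∧
      (∀ s t i j, i < j → a s i ≠ 0 → |a t j| ≤ |a s i|) ∧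
      ∀ s, MeasurableSet (B s) ∧ coin.real (B s) ≤ 1 / 2 ^ k s ∧
        (∀ ω ∉ B s, psum (a s) (2 ^ L (s + 1)) ω = v s ω) ∧
        (∀ M ω, |psum (a s) M ω| ≤ 2 ^ (k s + 1) * V s + 1) ∧
        ∀ M, ∃ G, MeasurableSet G ∧ coin.real G ≤ κ s ∧
          ∀ ω, ω ∉ B s → ω ∉ G → |psum (a s) M ω| ≤ |v s ω| + η s := by
  -- The state consists of the position and of the bound for the coefficients still to come.
  have hstep : ∀ (s : ℕ) (x : ℕ × {τ : ℝ // 0 < τ}),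
      ∃ y : (ℕ → ℝ) × Set (ℕ → Bool) × (ℕ × {τ : ℝ // 0 < τ}),
        x.1 < y.2.2.1 ∧ IsBlock y.1 x.1 y.2.2.1 x.2 ∧ (y.2.2.2 : ℝ) ≤ x.2 ∧
        (∀ i, y.1 i ≠ 0 → (y.2.2.2 : ℝ) ≤ |y.1 i|) ∧ MeasurableSet y.2.1 ∧
        coin.real y.2.1 ≤ 1 / 2 ^ k s ∧ (∀ ω ∉ y.2.1, psum y.1 (2 ^ y.2.2.1) ω = v s ω) ∧
        (∀ M ω, |psum y.1 M ω| ≤ 2 ^ (k s + 1) * V s + 1) ∧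
        ∀ M, ∃ G, MeasurableSet G ∧ coin.real G ≤ κ s ∧
          ∀ ω, ω ∉ y.2.1 → ω ∉ G → |psum y.1 M ω| ≤ |v s ω| + η s := by
    rintro s ⟨L, τ, hτ⟩
    obtain ⟨a, R, B, hR, ha, hB, hBm, hfull, hK, hbd⟩ :=
      exists_block (hv s) (hV s) (k s) L hτ (hη s) (hη1 s) (hκ s)
    obtain ⟨σ, hσ, hlow⟩ := ha.exists_lower_bound
    refine ⟨(a, B, R + 1, ⟨min τ σ, lt_min hτ hσ⟩), Nat.lt_succ_of_le hR,
      ⟨fun i hi => ⟨(ha.supp i hi).1, (ha.supp i hi).2.trans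
        (Nat.pow_lt_pow_right one_lt_two R.lt_succ_self)⟩, ha.anti, ha.le, ha.decay⟩,
      min_le_left _ _, fun i hi => (min_le_right _ _).trans (hlow i hi), hB, hBm,
      fun ω hω => ?_, hK, hbd⟩
    rw [← hfull ω hω]
    exact ha.psum_of_ge (Nat.pow_le_pow_right two_pos R.le_succ) ω
  choose y hlt hblock hle hlow hmeas hcoin hfull hK hbd using hstep
  let x : ℕ → ℕ × {τ : ℝ // 0 < τ} := fun s =>
    Nat.rec (0, ⟨1, one_pos⟩) (fun s x => (y s x).2.2) s
  have hxs : ∀ s, x (s + 1) = (y s (x s)).2.2 := fun s => rfl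
  have hanti : Antitone fun s => ((x s).2 : ℝ) :=
    antitone_nat_of_succ_le fun s => by rw [hxs]; exact hle s (x s)
  have hmono : StrictMono fun s => (x s).1 :=
    strictMono_nat_of_lt_succ fun s => by rw [hxs]; exact hlt s (x s)
  refine ⟨fun s => (y s (x s)).1, fun s => (x s).1, fun s => (y s (x s)).2.1, hmono,
    fun s => ?_, fun s t i j hij hi => ?_, fun s =>
      ⟨hmeas s _, hcoin s _, hfull s _, hK s _, hbd s _⟩⟩
  · have h := hblock s (x s)
    exact ⟨h.supp, h.anti, fun i => (h.le i).trans (hanti (Nat.zero_le s)), h.decay⟩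
  · have hs := hblock s (x s)
    have ht := hblock t (x t)
    rcases lt_trichotomy s t with h | rfl | h
    · exact ((ht.le j).trans (hanti h)).trans (hlow s (x s) i hi)
    · exact hs.anti i j hij hi
    · have h1 : 2 ^ (y t (x t)).2.2.1 ≤ 2 ^ (x s).1 :=
        Nat.pow_le_pow_right two_pos (hmono.monotone (Nat.succ_le_of_lt h))
      change |(y t (x t)).1 j| ≤ |(y s (x s)).1 i|
      rw [ht.eq_zero_of_le (h1.trans ((hs.supp i hi).1.trans hij.le)), abs_zero]
      exact abs_nonneg _

/-! ### Decreasing coefficients -/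

/-- A sequence with nonincreasing absolute values, apart from zeros, is obtained by inserting
factors `-1`, `0`, `1` into a strictly decreasing positive sequence `c`, up to a fixed summable
error: take `c k = sup_{l ≥ k} |A l| + 2 ^ (-k)`. -/
lemma exists_strictAnti_coeff {A : ℕ → ℝ} (hanti : ∀ i j, i < j → A i ≠ 0 → |A j| ≤ |A i|)
    (hdecay : ∀ i, |A i| ≤ (3 / 4) ^ Nat.log 2 i) :
    ∃ c θ : ℕ → ℝ, (∀ k, 0 < c k) ∧ StrictAnti c ∧
      (∀ k, c k ≤ (3 / 4) ^ Nat.log 2 k + (1 / 2) ^ k) ∧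
      (∀ k, θ k = -1 ∨ θ k = 0 ∨ θ k = 1) ∧ ∀ k, |θ k * c k - A k| ≤ (1 / 2) ^ k := by
  have hpow : ∀ k l, (3 / 4 : ℝ) ^ Nat.log 2 (k + l) ≤ (3 / 4) ^ Nat.log 2 k := fun k l =>
    pow_le_pow_of_le_one (by norm_num) (by norm_num) (Nat.log_mono_right (Nat.le_add_right k l))
  have hle : ∀ k l, |A (k + l)| ≤ (3 / 4) ^ Nat.log 2 k := fun k l =>
    (hdecay _).trans (hpow k l)
  have hbdd : ∀ k, BddAbove (range fun l => |A (k + l)|) := by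
    rintro k
    exact ⟨_, by rintro _ ⟨l, rfl⟩; exact hle k l⟩
  set b : ℕ → ℝ := fun k => ⨆ l, |A (k + l)|
  have hb0 : ∀ k, 0 ≤ b k := fun k => Real.iSup_nonneg fun l => abs_nonneg _
  have hbanti : Antitone b := by
    refine antitone_nat_of_succ_le fun k => ciSup_le fun l => ?_
    rw [show k + 1 + l = k + (1 + l) by ring]
    exact le_ciSup (hbdd k) (1 + l)
  have hbA : ∀ k, A k ≠ 0 → b k = |A k| := by
    intro k hk
    refine le_antisymm (ciSup_le fun l => ?_) (le_ciSup (hbdd k) 0)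
    rcases Nat.eq_zero_or_pos l with rfl | hl
    · rfl
    · exact hanti k _ (by omega) hk
  refine ⟨fun k => b k + (1 / 2) ^ k, fun k => Real.sign (A k), fun k => ?_, ?_, fun k => ?_,
    fun k => ?_, fun k => ?_⟩
  · have := hb0 k; positivity
  · refine strictAnti_nat_of_succ_lt fun k => add_lt_add_of_le_of_lt (hbanti k.le_succ) ?_
    exact pow_lt_pow_right_of_lt_one₀ (by norm_num) (by norm_num) k.lt_succ_self
  · exact add_le_add (ciSup_le fun l => hle k l) le_rfl
  · exact Real.sign_apply_eq (A k)
  · rcases lt_trichotomy (A k) 0 with h | h | h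
    · simp only [Real.sign_of_neg h, hbA k h.ne, abs_of_neg h]
      rw [show -1 * (-A k + (1 / 2) ^ k) - A k = -(1 / 2) ^ k by ring, abs_neg,
        abs_of_nonneg (by positivity)]
    · simp only [h, Real.sign_zero, zero_mul, sub_zero, abs_zero]
      positivity
    · simp only [Real.sign_of_pos h, hbA k h.ne', abs_of_pos h]
      rw [show 1 * (A k + (1 / 2) ^ k) - A k = (1 / 2) ^ k by ring,
        abs_of_nonneg (by positivity)]

/-- Infinitely many consecutive blocks are joined into one sequence. -/
lemma exists_strictAnti_coeff_of_blocks {a : ℕ → ℕ → ℝ} {L : ℕ → ℕ} (hL : StrictMono L)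
    (ha : ∀ s, IsBlock (a s) (L s) (L (s + 1)) 1)
    (hanti : ∀ s t i j, i < j → a s i ≠ 0 → |a t j| ≤ |a s i|) :
    ∃ c θ : ℕ → ℝ, (∀ k, 0 < c k) ∧ StrictAnti c ∧
      (∀ k, c k ≤ (3 / 4) ^ Nat.log 2 k + (1 / 2) ^ k) ∧
      (∀ k, θ k = -1 ∨ θ k = 0 ∨ θ k = 1) ∧
      ∀ s k, 2 ^ L s ≤ k → k < 2 ^ L (s + 1) → |θ k * c k - a s k| ≤ (1 / 2) ^ k := by
  set A : ℕ → ℝ := fun k => ∑ s ∈ Finset.range (k + 1), a s k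
  have hAs : ∀ s k, 2 ^ L s ≤ k → k < 2 ^ L (s + 1) → A k = a s k := by
    intro s k h1 h2
    refine Finset.sum_eq_single_of_mem s ?_ fun t _ hts => ?_
    · have := hL.id_le s
      have := (Nat.lt_two_pow_self (n := L s)).le
      simp only [id] at *
      rw [Finset.mem_range]
      omega
    · rcases lt_or_gt_of_ne hts with h | h
      · exact (ha t).eq_zero_of_le
          ((Nat.pow_le_pow_right two_pos (hL.monotone (Nat.succ_le_of_lt h))).trans h1)
      · exact (ha t).eq_zero_of_lt
          (h2.trans_le (Nat.pow_le_pow_right two_pos (hL.monotone (Nat.succ_le_of_lt h))))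
  have hex : ∀ k, A k ≠ 0 → ∃ s, a s k ≠ 0 ∧ A k = a s k := by
    intro k hk
    obtain ⟨s, -, hs⟩ := Finset.exists_ne_zero_of_sum_ne_zero hk
    exact ⟨s, hs, hAs s k ((ha s).supp k hs).1 ((ha s).supp k hs).2⟩
  obtain ⟨c, θ, h1, h2, h3, h4, h5⟩ := exists_strictAnti_coeff (A := A)
    (fun i j hij hi => by
      obtain ⟨s, hs, hsA⟩ := hex i hi
      rw [hsA]
      by_cases hj : A j = 0
      · rw [hj, abs_zero]; exact abs_nonneg _
      · obtain ⟨t, -, htA⟩ := hex j hj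
        rw [htA]
        exact hanti s t i j hij hs)
    (fun i => by
      by_cases hi : A i = 0
      · rw [hi, abs_zero]; positivity
      · obtain ⟨s, -, hsA⟩ := hex i hi
        rw [hsA]
        exact (ha s).decay i)
  exact ⟨c, θ, h1, h2, h3, h4, fun s k hk hk' => hAs s k hk hk' ▸ h5 k⟩

/-! ### Convergence in mean of Walsh series with decreasing coefficients -/

/-- The Lebesgue constants of the Walsh system grow at most logarithmically: split off the
dyadic part of the Dirichlet kernel, which is nonnegative and has integral one. -/
lemma integral_abs_sum_cwalsh_le (n : ℕ) : ∀ J ≤ 2 ^ n,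
    ∫ ω, |∑ j ∈ Finset.range J, cwalsh j ω| ∂coin ≤ n + 1 := by
  have hint : ∀ J, Integrable (fun ω => ∑ j ∈ Finset.range J, cwalsh j ω) coin := fun J =>
    integrable_finsetSum _ fun k _ => integrable_cwalsh k
  have hdyadic : ∀ n, ∫ ω, |∑ j ∈ Finset.range (2 ^ n), cwalsh j ω| ∂coin = 1 := by
    intro n
    simp_rw [fun ω => abs_of_nonneg (sum_cwalsh_nonneg n ω)]
    rw [integral_finsetSum _ fun k _ => integrable_cwalsh k, Finset.sum_eq_single 0]
    · simp
    · exact fun j _ hj => integral_cwalsh hj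
    · intro h; simp at h
  induction n with
  | zero =>
    intro J hJ
    rcases Nat.le_one_iff_eq_zero_or_eq_one.1 hJ with rfl | rfl <;> simp
  | succ n ih =>
    intro J hJ
    rcases le_total J (2 ^ n) with h | h
    · exact (ih J h).trans (by push_cast; linarith)
    · rcases hJ.eq_or_lt with rfl | hJ
      · rw [hdyadic]; push_cast; linarith [(Nat.cast_nonneg n : (0 : ℝ) ≤ n)]
      obtain ⟨T, rfl⟩ := Nat.exists_eq_add_of_le h
      have hT : T < 2 ^ n := by rw [pow_succ] at hJ; omega
      calc ∫ ω, |∑ j ∈ Finset.range (2 ^ n + T), cwalsh j ω| ∂coin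
          ≤ ∫ ω, (|∑ j ∈ Finset.range (2 ^ n), cwalsh j ω| +
              |∑ j ∈ Finset.range T, cwalsh j ω|) ∂coin := by
            refine integral_mono (hint _).abs ((hint _).abs.add (hint _).abs) fun ω => ?_
            simp only
            rw [Finset.sum_range_add]
            refine (abs_add_le _ _).trans (add_le_add_right (le_of_eq ?_) _)
            rw [Finset.sum_congr rfl fun j hj => cwalsh_two_pow_add
              ((Finset.mem_range.1 hj).trans hT) ω, ← Finset.mul_sum, abs_mul, abs_cwalsh,
              one_mul]
        _ ≤ 1 + (n + 1) := by
            rw [integral_add (hint _).abs (hint _).abs, hdyadic]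
            exact add_le_add_right (ih T hT.le) _
        _ = _ := by push_cast; ring

/-- Abel's inequality. -/
lemma norm_sum_smul_le_of_antitone {X : Type*} [NormedAddCommGroup X] [NormedSpace ℝ X]
    {c : ℕ → ℝ} (hc : Antitone c) (hc0 : ∀ k, 0 ≤ c k) {y : ℕ → X} {G : ℝ} {N : ℕ}
    (hy : ∀ J ≤ N, ‖∑ j ∈ Finset.range J, y j‖ ≤ G) :
    ∀ J ≤ N, ‖∑ j ∈ Finset.range J, c j • y j‖ ≤ c 0 * G := by
  have key : ∀ J ≤ N, ‖∑ j ∈ Finset.range J, c j • y j - c J • ∑ j ∈ Finset.range J, y j‖ ≤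
      (c 0 - c J) * G := by
    intro J
    induction J with
    | zero => simp
    | succ J ih =>
      intro hJ
      have h1 : ∑ j ∈ Finset.range (J + 1), c j • y j -
          c (J + 1) • ∑ j ∈ Finset.range (J + 1), y j =
          (∑ j ∈ Finset.range J, c j • y j - c J • ∑ j ∈ Finset.range J, y j) +
            (c J - c (J + 1)) • ∑ j ∈ Finset.range (J + 1), y j := by
        rw [Finset.sum_range_succ, Finset.sum_range_succ]
        module
      rw [h1]
      refine (norm_add_le _ _).trans ?_
      rw [norm_smul, Real.norm_of_nonneg (sub_nonneg.2 (hc J.le_succ))]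
      have h2 := mul_le_mul_of_nonneg_left (hy (J + 1) hJ) (sub_nonneg.2 (hc J.le_succ))
      have h3 := ih (by omega)
      linarith
  intro J hJ
  have h1 : ∑ j ∈ Finset.range J, c j • y j =
      (∑ j ∈ Finset.range J, c j • y j - c J • ∑ j ∈ Finset.range J, y j) +
        c J • ∑ j ∈ Finset.range J, y j := by abel
  rw [h1]
  refine (norm_add_le _ _).trans ?_
  rw [norm_smul, Real.norm_of_nonneg (hc0 J)]
  have h2 := mul_le_mul_of_nonneg_left (hy J hJ) (hc0 J)
  have h3 := key J hJ
  linarith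

/-- A sequence converges as soon as its oscillations over the dyadic blocks are summable. -/
lemma cauchySeq_of_dyadic {X : Type*} [NormedAddCommGroup X] {T : ℕ → X} {d : ℕ → ℝ}
    (hd : Summable d) (h : ∀ n, ∀ J ≤ 2 ^ n, ‖T (2 ^ n + J) - T (2 ^ n)‖ ≤ d n) :
    CauchySeq T := by
  have hdy : CauchySeq fun n => T (2 ^ n) := by
    refine cauchySeq_of_dist_le_of_summable d (fun n => ?_) hd
    rw [dist_comm, dist_eq_norm, pow_succ, mul_two]
    exact h n _ le_rfl
  rw [Metric.cauchySeq_iff'] at hdy ⊢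
  intro ε hε
  obtain ⟨N, hN⟩ := hdy (ε / 4) (by positivity)
  obtain ⟨N', hN'⟩ := eventually_atTop.1 (hd.tendsto_atTop_zero.eventually_lt_const
    (show 0 < ε / 4 by positivity))
  have key : ∀ m ≥ 2 ^ max N N', dist (T m) (T (2 ^ N)) < ε / 2 := by
    intro m hm
    have hm0 : m ≠ 0 := by have := Nat.two_pow_pos (max N N'); omega
    have hlog : max N N' ≤ Nat.log 2 m := Nat.le_log_of_pow_le one_lt_two hm
    obtain ⟨J, hJ⟩ := Nat.exists_eq_add_of_le (Nat.pow_log_le_self 2 hm0)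
    have hlt := Nat.lt_pow_succ_log_self one_lt_two m
    rw [Nat.succ_eq_add_one, pow_succ] at hlt
    have h1 := h (Nat.log 2 m) J (by omega)
    rw [← hJ] at h1
    have h2 := hN (Nat.log 2 m) (le_of_max_le_left hlog)
    have h3 := hN' (Nat.log 2 m) (le_of_max_le_right hlog)
    calc dist (T m) (T (2 ^ N)) ≤ dist (T m) (T (2 ^ Nat.log 2 m)) +
          dist (T (2 ^ Nat.log 2 m)) (T (2 ^ N)) := dist_triangle _ _ _
      _ < ε / 4 + ε / 4 := by rw [dist_eq_norm]; linarith
      _ = ε / 2 := by ring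
  refine ⟨2 ^ max N N', fun m hm => ?_⟩
  calc dist (T m) (T (2 ^ max N N')) ≤ dist (T m) (T (2 ^ N)) +
        dist (T (2 ^ max N N')) (T (2 ^ N)) := dist_triangle_right _ _ _
    _ < ε / 2 + ε / 2 := add_lt_add (key m hm) (key _ le_rfl)
    _ = ε := by ring

lemma integral_walsh_mul_walsh (j k : ℕ) :
    ∫ x, walsh j x * walsh k x ∂unitMeasure = if j = k then 1 else 0 := by
  have h : ∀ᵐ x ∂unitMeasure, walsh j x * walsh k x = walsh (j ^^^ k) x := by
    filter_upwards [ae_unit_nonDyadic] with x hx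
    simp_rw [walsh_eq_cwalsh hx, cwalsh_xor]
  rw [integral_congr_ae h]
  split_ifs with hjk
  · subst hjk
    simp [walsh]
  · exact integral_walsh fun h0 => hjk (Nat.xor_eq_zero_iff.1 h0)

lemma abs_walsh_le (n : ℕ) (x : ℝ) : |walsh n x| ≤ 1 := by
  rw [walsh, Finset.abs_prod]
  refine Finset.prod_le_one (fun _ _ => abs_nonneg _) fun k _ => ?_
  unfold rademacher
  rcases Real.sign_apply_eq (Real.sin (2 ^ (k + 1) * Real.pi * x)) with h | h | h <;>
    rw [h] <;> norm_num

lemma memLp_walsh (n : ℕ) (p : ENNReal) (m : Measure ℝ) [IsFiniteMeasure m] :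
    MemLp (walsh n) p m :=
  MemLp.of_bound (measurable_walsh n).aestronglyMeasurable 1
    (Eventually.of_forall (abs_walsh_le n))

/-- The `n`-th Walsh function as an element of `L^p(m)`. -/
noncomputable def walshLp (p : ENNReal) (m : Measure ℝ) [IsFiniteMeasure m] (n : ℕ) : Lp ℝ p m :=
  (memLp_walsh n p m).toLp _

lemma memLp_walsh_sum (p : ENNReal) (m : Measure ℝ) [IsFiniteMeasure m] (s : Finset ℕ)
    (c : ℕ → ℝ) : MemLp (fun x => ∑ k ∈ s, c k * walsh k x) p m :=
  memLp_finsetSum _ fun k _ => (memLp_walsh k p m).const_mul (c k)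

lemma sum_smul_walshLp (p : ENNReal) (m : Measure ℝ) [IsFiniteMeasure m] (s : Finset ℕ)
    (c : ℕ → ℝ) :
    ∑ k ∈ s, c k • walshLp p m k = (memLp_walsh_sum p m s c).toLp _ := by
  induction s using Finset.cons_induction with
  | empty =>
    simp only [Finset.sum_empty]
    rfl
  | cons k s hk ih =>
    rw [Finset.sum_cons, ih, walshLp, ← MemLp.toLp_const_smul, ← MemLp.toLp_add]
    congr 1
    ext x
    simp only [Finset.sum_cons, Pi.add_apply, Pi.smul_apply, smul_eq_mul]

lemma norm_sum_smul_walshLp (p : ENNReal) (m : Measure ℝ) [IsFiniteMeasure m] (s : Finset ℕ)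
    (c : ℕ → ℝ) :
    ‖∑ k ∈ s, c k • walshLp p m k‖ =
      (eLpNorm (fun x => ∑ k ∈ s, c k * walsh k x) p m).toReal := by
  rw [sum_smul_walshLp, Lp.norm_toLp]

lemma norm_walshLp_block_le {n J : ℕ} (hJ : J ≤ 2 ^ n) :
    ‖∑ j ∈ Finset.range J, walshLp 1 unitMeasure (2 ^ n + j)‖ ≤ n + 1 := by
  have h0 : ∑ j ∈ Finset.range J, walshLp 1 unitMeasure (2 ^ n + j) =
      ∑ k ∈ (Finset.range J).map (addLeftEmbedding (2 ^ n)),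
        (1 : ℝ) • walshLp 1 unitMeasure k := by
    simp [Finset.sum_map]
  rw [h0, norm_sum_smul_walshLp, eLpNorm_one_eq_lintegral_enorm, ← integral_norm_eq_lintegral_enorm
    (memLp_walsh_sum 1 unitMeasure _ _).aestronglyMeasurable]
  refine le_trans (le_of_eq ?_) (integral_abs_sum_cwalsh_le n J hJ)
  rw [coin, integral_map measurable_digits.aemeasurable
    (Finset.measurable_sum _ fun k _ => measurable_cwalsh k).abs.aestronglyMeasurable]
  refine integral_congr_ae ?_
  filter_upwards [ae_unit_nonDyadic] with x hx
  rw [Finset.sum_map, Real.norm_eq_abs]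
  simp only [addLeftEmbedding_apply, one_mul, walsh_eq_cwalsh hx]
  rw [Finset.sum_congr rfl fun j hj => cwalsh_two_pow_add
    ((Finset.mem_range.1 hj).trans_le hJ) _, ← Finset.mul_sum, abs_mul, abs_cwalsh, one_mul]

lemma summable_dyadic_bound :
    Summable fun n : ℕ => ((3 / 4 : ℝ) ^ n + (1 / 2) ^ n) * (n + 1) := by
  have h : ∀ r : ℝ, 0 ≤ r → r < 1 → Summable fun n : ℕ => (n : ℝ) * r ^ n + r ^ n := by
    intro r h0 h1
    refine Summable.add ?_ (summable_geometric_of_lt_one h0 h1)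
    simpa using summable_pow_mul_geometric_of_norm_lt_one 1
      (show ‖r‖ < 1 by rwa [Real.norm_of_nonneg h0])
  refine ((h (3 / 4) (by norm_num) (by norm_num)).add
    (h (1 / 2) (by norm_num) (by norm_num))).congr fun n => ?_
  ring

lemma cauchySeq_walsh_sum {c : ℕ → ℝ} (hc : Antitone c) (hc0 : ∀ k, 0 ≤ c k)
    (hcle : ∀ k, c k ≤ (3 / 4) ^ Nat.log 2 k + (1 / 2) ^ k) :
    CauchySeq fun M => ∑ k ∈ Finset.range M, c k • walshLp 1 unitMeasure k := by
  refine cauchySeq_of_dyadic summable_dyadic_bound fun n J hJ => ?_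
  rw [Finset.sum_range_add, add_sub_cancel_left]
  have h := norm_sum_smul_le_of_antitone (c := fun j => c (2 ^ n + j))
    (y := fun j => walshLp 1 unitMeasure (2 ^ n + j)) (N := 2 ^ n)
    (fun i j hij => hc (Nat.add_le_add_left hij _)) (fun k => hc0 _)
    (fun J hJ => norm_walshLp_block_le hJ) J hJ
  refine h.trans ?_
  rw [add_zero]
  gcongr
  refine (hcle _).trans ?_
  rw [Nat.log_pow one_lt_two]
  refine add_le_add le_rfl ?_
  exact pow_le_pow_of_le_one (by norm_num) (by norm_num) Nat.lt_two_pow_self.le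

/-- Decreasing coefficients with this decay are the Walsh coefficients of an integrable function
whose Walsh series converges in mean. -/
lemma exists_integrable_of_coeff {c : ℕ → ℝ} (hc : Antitone c) (hc0 : ∀ k, 0 ≤ c k)
    (hcle : ∀ k, c k ≤ (3 / 4) ^ Nat.log 2 k + (1 / 2) ^ k) :
    ∃ g : ℝ → ℝ, IntegrableOn g (Icc (0 : ℝ) 1) ∧ (∀ k, walshCoeff g k = c k) ∧
      Tendsto (fun M : ℕ => ∫⁻ x in Icc (0 : ℝ) 1, ENNReal.ofReal
        |(∑ k ∈ Finset.range M, c k * walsh k x) - g x|) atTop (𝓝 0) := by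
  obtain ⟨G, hG⟩ := cauchySeq_tendsto_of_complete (cauchySeq_walsh_sum hc hc0 hcle)
  have hGi : Integrable G unitMeasure := memLp_one_iff_integrable.1 (Lp.memLp G)
  have hlim : Tendsto (fun M : ℕ => ∫⁻ x in Icc (0 : ℝ) 1, ENNReal.ofReal
        |(∑ k ∈ Finset.range M, c k * walsh k x) - G x|) atTop (𝓝 0) := by
    rw [tendsto_iff_dist_tendsto_zero] at hG
    have h := ENNReal.tendsto_ofReal hG
    rw [ENNReal.ofReal_zero] at h
    refine h.congr fun M => ?_
    rw [dist_eq_norm, sum_smul_walshLp, Lp.norm_def, ENNReal.ofReal_toReal (Lp.eLpNorm_ne_top _),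
      eLpNorm_one_eq_lintegral_enorm]
    refine lintegral_congr_ae ?_
    filter_upwards [Lp.coeFn_sub ((memLp_walsh_sum 1 unitMeasure (Finset.range M) c).toLp _) G,
      (memLp_walsh_sum 1 unitMeasure (Finset.range M) c).coeFn_toLp] with x h1 h2
    rw [h1, Pi.sub_apply, h2, Real.enorm_eq_ofReal_abs]
  refine ⟨G, hGi, fun k => ?_, hlim⟩
  have hsum : ∀ M, Integrable (fun x => ∑ k ∈ Finset.range M, c k * walsh k x) unitMeasure :=
    fun M => memLp_one_iff_integrable.1 (memLp_walsh_sum 1 unitMeasure _ c)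
  have hwb : ∀ f : ℝ → ℝ, Integrable f unitMeasure →
      Integrable (fun x => f x * walsh k x) unitMeasure := fun f hf =>
    hf.mul_bdd (c := 1) (measurable_walsh k).aestronglyMeasurable (Eventually.of_forall (abs_walsh_le k))
  have hcoef : ∀ M > k,
      ∫ x, (∑ j ∈ Finset.range M, c j * walsh j x) * walsh k x ∂unitMeasure = c k := by
    intro M hM
    simp_rw [Finset.sum_mul, mul_assoc]
    rw [integral_finsetSum _ fun j _ => (hwb _ (memLp_one_iff_integrable.1
      (memLp_walsh j 1 unitMeasure))).const_mul (c j)]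
    simp_rw [integral_const_mul, integral_walsh_mul_walsh]
    simp [hM]
  have hdiff : ∀ M > k, |c k - walshCoeff G k| ≤ (∫⁻ x in Icc (0 : ℝ) 1, ENNReal.ofReal
        |(∑ k ∈ Finset.range M, c k * walsh k x) - G x|).toReal := by
    intro M hM
    have hd : Integrable (fun x => (∑ k ∈ Finset.range M, c k * walsh k x) - G x) unitMeasure :=
      (hsum M).sub hGi
    rw [← hcoef M hM, walshCoeff, ← integral_sub (hwb _ (hsum M)) (hwb _ hGi)]
    simp_rw [← sub_mul]
    rw [← integral_eq_lintegral_of_nonneg_ae (Eventually.of_forall fun x => abs_nonneg _)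
      hd.abs.aestronglyMeasurable]
    refine (abs_integral_le_integral_abs).trans
      (integral_mono (hwb _ hd).abs hd.abs fun x => ?_)
    simp only [abs_mul]
    exact mul_le_of_le_one_right (abs_nonneg _) (abs_walsh_le k x)
  have hzero : |c k - walshCoeff G k| ≤ 0 := by
    have := (ENNReal.tendsto_toReal ENNReal.zero_ne_top).comp hlim
    exact ge_of_tendsto this ((eventually_gt_atTop k).mono hdiff)
  linarith [abs_nonpos_iff.1 hzero]

/-! ### Greedy choice of blocks -/

lemma exists_mem_consecutive {l : ℕ → ℕ} (hl : StrictMono l) {M : ℕ} (hM : l 0 ≤ M) :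
    ∃ s, l s ≤ M ∧ M < l (s + 1) := by
  classical
  have hex : ∃ t, M < l t := ⟨M + 1, (Nat.lt_succ_self M).trans_le (hl.id_le _)⟩
  have h0 : Nat.find hex ≠ 0 := fun h => absurd (h ▸ Nat.find_spec hex) (not_lt.2 hM)
  obtain ⟨s, hs⟩ := Nat.exists_eq_succ_of_ne_zero h0
  refine ⟨s, not_lt.1 (Nat.find_min hex (by omega)), ?_⟩
  have := Nat.find_spec hex
  rwa [hs] at this

lemma exists_lt_half_of_greedy {X : Type*} [NormedAddCommGroup X] {φ r : ℕ → X} {e : ℕ → ℝ}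
    {s₀ : ℕ} (he : Tendsto e atTop (𝓝 0))
    (hdense : ∀ x : X, ∀ ε > 0, ∀ n, ∃ s ≥ n, ‖x - φ s‖ < ε)
    (hkeep : ∀ s, r (s + 1) = r s ∨ ‖r (s + 1)‖ ≤ ‖r s‖ / 2)
    (hinc : ∀ s ≥ s₀, ‖r s - φ s‖ + e s ≤ ‖r s‖ / 2 → ‖r (s + 1)‖ ≤ ‖r s‖ / 2) (s : ℕ) :
    ∃ t, ‖r t‖ ≤ ‖r s‖ / 2 := by
  rcases (norm_nonneg (r s)).eq_or_lt with h0 | h0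
  · exact ⟨s, by rw [← h0]; norm_num⟩
  obtain ⟨n, hn⟩ := eventually_atTop.1 (he.eventually_lt_const (by positivity : 0 < ‖r s‖ / 4))
  obtain ⟨t, ht, hφ⟩ := hdense (r s) (‖r s‖ / 4) (by positivity) (max s (max n s₀))
  have hst : s ≤ t := (le_max_left _ _).trans ht
  have key : ∀ t ≥ s, r t = r s ∨ ‖r t‖ ≤ ‖r s‖ / 2 := by
    intro t hst
    induction t, hst using Nat.le_induction with
    | base => exact Or.inl rfl
    | succ t _ ih =>
      rcases hkeep t with h | h
      · rwa [h]
      · right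
        rcases ih with h' | h'
        · rwa [h'] at h
        · have := norm_nonneg (r t)
          linarith
  rcases key t hst with h | h
  · refine ⟨t + 1, ?_⟩
    have := hinc t ((le_max_right _ _).trans ((le_max_right _ _).trans ht)) (by
      rw [h]
      have := hn t ((le_max_left _ _).trans ((le_max_right _ _).trans ht))
      linarith)
    rwa [h] at this
  · exact ⟨t, h⟩

/-- Let blocks of a series approximate the members of a sequence `φ` that comes back infinitely
often to every open set, with control on the partial sums. Including a block exactly when it
is sure to halve the current remainder makes the remainders tend to zero. -/
lemma exists_greedy_subseries {X : Type*} [NormedAddCommGroup X] [NormedSpace ℝ X] {w φ : ℕ → X}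
    {c θ e : ℕ → ℝ} {l : ℕ → ℕ} {s₀ : ℕ} (hl : StrictMono l)
    (hθ : ∀ k, θ k = -1 ∨ θ k = 0 ∨ θ k = 1) (he : Tendsto e atTop (𝓝 0))
    (hdense : ∀ x : X, ∀ ε > 0, ∀ n, ∃ s ≥ n, ‖x - φ s‖ < ε)
    (hfull : ∀ s ≥ s₀, ‖∑ k ∈ Finset.Ico (l s) (l (s + 1)), (θ k * c k) • w k - φ s‖ ≤ e s)
    (hpart : ∀ s ≥ s₀, ∀ M ≤ l (s + 1),
      ‖∑ k ∈ Finset.Ico (l s) M, (θ k * c k) • w k‖ ≤ ‖φ s‖ + e s) (f : X) :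
    ∃ δ : ℕ → ℝ, (∀ k, δ k = -1 ∨ δ k = 0 ∨ δ k = 1) ∧
      Tendsto (fun M => ∑ k ∈ Finset.range M, (δ k * c k) • w k) atTop (𝓝 f) := by
  classical
  let inc : ℕ → X → Prop := fun s x => s₀ ≤ s ∧ ‖x - φ s‖ + e s ≤ ‖x‖ / 2
  let Q : ℕ → ℕ → X := fun s M => ∑ k ∈ Finset.Ico (l s) M, (θ k * c k) • w k
  let r : ℕ → X := fun s =>
    Nat.rec f (fun s x => if inc s x then x - Q s (l (s + 1)) else x) s
  have hr : ∀ s, r (s + 1) = if inc s (r s) then r s - Q s (l (s + 1)) else r s := fun s => rfl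
  have hhalf : ∀ s, inc s (r s) → ‖r (s + 1)‖ ≤ ‖r s‖ / 2 := by
    intro s hs
    rw [hr, if_pos hs]
    have h1 : r s - Q s (l (s + 1)) = (r s - φ s) - (Q s (l (s + 1)) - φ s) := by abel
    rw [h1]
    exact (norm_sub_le _ _).trans ((add_le_add le_rfl (hfull s hs.1)).trans hs.2)
  have hkeep : ∀ s, r (s + 1) = r s ∨ ‖r (s + 1)‖ ≤ ‖r s‖ / 2 := by
    intro s
    by_cases hs : inc s (r s)
    · exact Or.inr (hhalf s hs)
    · exact Or.inl (by rw [hr, if_neg hs])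
  have hanti : Antitone fun s => ‖r s‖ := antitone_nat_of_succ_le fun s => by
    rcases hkeep s with h | h
    · rw [h]
    · have := norm_nonneg (r s)
      linarith
  have hr0 : Tendsto (fun s => ‖r s‖) atTop (𝓝 0) := by
    have hlim := tendsto_atTop_ciInf hanti ⟨0, by rintro _ ⟨s, rfl⟩; exact norm_nonneg _⟩
    set ℓ := ⨅ s, ‖r s‖
    have h0 : 0 ≤ ℓ := ge_of_tendsto' hlim fun s => norm_nonneg _
    have h1 : ℓ ≤ ℓ / 2 := by
      refine ge_of_tendsto' (hlim.div_const 2) fun s => ?_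
      obtain ⟨t, ht⟩ := exists_lt_half_of_greedy he hdense hkeep
        (fun s hs h => hhalf s ⟨hs, h⟩) s
      exact (hanti.le_of_tendsto hlim t).trans ht
    rwa [show ℓ = 0 by linarith] at hlim
  let δ : ℕ → ℝ := fun k =>
    if ∃ s, l s ≤ k ∧ k < l (s + 1) ∧ inc s (r s) then θ k else 0
  have hδ : ∀ s k, l s ≤ k → k < l (s + 1) → δ k = if inc s (r s) then θ k else 0 := by
    intro s k h1 h2
    have huniq : ∀ t, l t ≤ k → k < l (t + 1) → t = s := by
      intro t h3 h4
      have h5 := hl.lt_iff_lt.1 (h1.trans_lt h4)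
      have h6 := hl.lt_iff_lt.1 (h3.trans_lt h2)
      omega
    by_cases hs : inc s (r s)
    · rw [if_pos hs]
      exact if_pos ⟨s, h1, h2, hs⟩
    · rw [if_neg hs]
      refine if_neg ?_
      rintro ⟨t, h3, h4, h5⟩
      exact hs (huniq t h3 h4 ▸ h5)
  let P : ℕ → X := fun M => ∑ k ∈ Finset.range M, (δ k * c k) • w k
  have hP : ∀ s M, l s ≤ M → M ≤ l (s + 1) →
      P M = P (l s) + if inc s (r s) then Q s M else 0 := by
    intro s M h1 h2
    have h3 : P M = P (l s) + ∑ k ∈ Finset.Ico (l s) M, (δ k * c k) • w k :=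
      (Finset.sum_range_add_sum_Ico _ h1).symm
    rw [h3]
    congr 1
    have h4 : ∀ k ∈ Finset.Ico (l s) M, δ k = if inc s (r s) then θ k else 0 := fun k hk =>
      hδ s k (Finset.mem_Ico.1 hk).1 ((Finset.mem_Ico.1 hk).2.trans_le h2)
    rw [Finset.sum_congr rfl fun k hk => by rw [h4 k hk]]
    split_ifs
    · rfl
    · simp
  have hPr : ∀ s, f - P (l s) = r s := by
    intro s
    induction s with
    | zero =>
      have : P (l 0) = 0 := by
        refine Finset.sum_eq_zero fun k hk => ?_
        have hk0 : δ k = 0 := by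
          refine if_neg ?_
          rintro ⟨s, h1, -, -⟩
          exact absurd (Finset.mem_range.1 hk) (not_lt.2 ((hl.monotone (Nat.zero_le s)).trans h1))
        rw [hk0, zero_mul, zero_smul]
      rw [this, sub_zero]
      rfl
    | succ s ih =>
      rw [hP s _ (hl.monotone s.le_succ) le_rfl, hr, ← sub_sub, ih]
      split_ifs
      · rfl
      · rw [sub_zero]
  refine ⟨δ, fun k => ?_, ?_⟩
  · change (if _ then θ k else 0) = -1 ∨ (if _ then θ k else 0) = 0 ∨ (if _ then θ k else 0) = 1
    split_ifs
    · exact hθ k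
    · exact Or.inr (Or.inl rfl)
  · rw [Metric.tendsto_atTop]
    intro ε hε
    obtain ⟨n, hn⟩ := eventually_atTop.1 (hr0.eventually_lt_const (by positivity : 0 < ε / 4))
    refine ⟨l n, fun M hM => ?_⟩
    obtain ⟨s, h1, h2⟩ := exists_mem_consecutive hl ((hl.monotone (Nat.zero_le n)).trans hM)
    have hns : n ≤ s := by
      have := hl.lt_iff_lt.1 (hM.trans_lt h2)
      omega
    have h3 := hn s hns
    change dist (P M) f < ε
    rw [dist_comm, dist_eq_norm, hP s M h1 h2.le, ← sub_sub, hPr]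
    by_cases hs : inc s (r s)
    · rw [if_pos hs]
      have h4 := hpart s hs.1 M h2.le
      have h5 : ‖φ s‖ ≤ ‖r s‖ + ‖r s - φ s‖ := norm_le_norm_add_norm_sub _ _
      have h6 := hs.2
      have h7 := norm_nonneg (r s)
      refine (norm_sub_le _ _).trans_lt ?_
      change ‖r s‖ + ‖∑ k ∈ Finset.Ico (l s) M, (θ k * c k) • w k‖ < ε
      linarith
    · rw [if_neg hs, sub_zero]
      linarith

/-! ### The weight -/

/-- A weight that is as small as prescribed on each set `B s`, and equal to `1` elsewhere. It is
positive because, by the Borel–Cantelli lemma, almost every point lies in finitely many `B s`. -/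
lemma exists_weight {B : ℕ → Set ℝ} {κ : ℕ → ℝ} (hB : ∀ s, MeasurableSet (B s))
    (hκ : ∀ s, 0 < κ s) (hsum : ∑' s, unitMeasure (B s) ≠ ⊤) :
    ∃ μ : ℝ → ℝ, Measurable μ ∧ (∀ x, 0 < μ x ∧ μ x ≤ 1) ∧
      (∀ s, ∀ᵐ x ∂unitMeasure, x ∈ B s → μ x ≤ κ s) ∧ ∀ x, (∀ s, x ∉ B s) → μ x = 1 := by
  classical
  let W : ℝ → ENNReal := fun x => ∑' s, (B s).indicator (fun _ => ENNReal.ofReal (1 / κ s)) x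
  have hW : Measurable W := Measurable.tsum fun s => measurable_const.indicator (hB s)
  have hWae : ∀ᵐ x ∂unitMeasure, W x ≠ ⊤ := by
    filter_upwards [ae_finite_setOfPred_mem hsum] with x hx
    have : W x = ∑ s ∈ hx.toFinset, (B s).indicator (fun _ => ENNReal.ofReal (1 / κ s)) x := by
      refine tsum_eq_sum fun s hs => ?_
      rw [indicator_of_notMem]
      simpa using hs
    rw [this]
    refine ENNReal.sum_ne_top.2 fun s _ => ?_
    rw [indicator_apply]
    split_ifs
    · exact ENNReal.ofReal_ne_top
    · exact ENNReal.zero_ne_top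
  refine ⟨fun x => if W x = ⊤ then 1 else ((1 + W x)⁻¹).toReal, ?_, fun x => ?_, fun s => ?_,
    fun x hx => ?_⟩
  · exact Measurable.ite (hW (measurableSet_singleton ⊤)) measurable_const
      (measurable_const.add hW).inv.ennreal_toReal
  · dsimp only
    split_ifs with h
    · exact ⟨one_pos, le_rfl⟩
    · have h1 : (1 + W x)⁻¹ ≤ 1 := ENNReal.inv_le_one.2 le_self_add
      refine ⟨ENNReal.toReal_pos (ENNReal.inv_ne_zero.2 (by simp [h])) (ne_top_of_le_ne_top
        ENNReal.one_ne_top h1), ?_⟩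
      simpa using ENNReal.toReal_mono ENNReal.one_ne_top h1
  · filter_upwards [hWae] with x hx hxs
    rw [if_neg hx]
    have h1 : ENNReal.ofReal (1 / κ s) ≤ 1 + W x := by
      have h2 := ENNReal.le_tsum
        (f := fun s => (B s).indicator (fun _ => ENNReal.ofReal (1 / κ s)) x) s
      rw [indicator_of_mem hxs] at h2
      exact h2.trans le_add_self
    have h3 : (1 + W x)⁻¹ ≤ ENNReal.ofReal (κ s) := by
      refine (ENNReal.inv_le_inv.2 h1).trans (le_of_eq ?_)
      rw [← ENNReal.ofReal_inv_of_pos (by have := hκ s; positivity), one_div, inv_inv]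
    exact (ENNReal.toReal_mono ENNReal.ofReal_ne_top h3).trans
      (ENNReal.toReal_ofReal (hκ s).le).le
  · have : W x = 0 := by
      simp only [W, ENNReal.tsum_eq_zero]
      exact fun s => indicator_of_notMem (hx s) _
    simp [this]

/-! ### Density of rational step functions -/

lemma floor_two_mul {z : ℝ} (hz : Real.sin (2 * Real.pi * z) ≠ 0) :
    ⌊2 * z⌋ = 2 * ⌊z⌋ + if Real.sin (2 * Real.pi * z) < 0 then 1 else 0 := by
  have hπ := Real.pi_pos
  have hs : Real.sin (2 * Real.pi * z) = Real.sin (2 * Real.pi * Int.fract z) := by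
    have h1 : 2 * Real.pi * z = 2 * Real.pi * Int.fract z + ⌊z⌋ * (2 * Real.pi) := by
      have := Int.fract_add_floor z
      linear_combination (-2 * Real.pi) * this
    rw [h1, Real.sin_add_int_mul_two_pi]
  have h0 := Int.fract_nonneg z
  have h1 := Int.fract_lt_one z
  have hfl := Int.fract_add_floor z
  rcases lt_or_ge (Int.fract z) (1 / 2) with h | h
  · rw [if_neg, Int.floor_eq_iff]
    · push_cast
      constructor <;> linarith
    · rw [hs, not_lt]
      exact Real.sin_nonneg_of_nonneg_of_le_pi (by positivity) (by nlinarith)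
  · rw [if_pos, Int.floor_eq_iff]
    · push_cast
      constructor <;> linarith
    · refine lt_of_le_of_ne ?_ hz
      rw [hs]
      have h2 : Real.sin (2 * Real.pi * Int.fract z - Real.pi) =
          -Real.sin (2 * Real.pi * Int.fract z) := Real.sin_sub_pi _
      have h3 : 0 ≤ Real.sin (2 * Real.pi * Int.fract z - Real.pi) :=
        Real.sin_nonneg_of_nonneg_of_le_pi (by nlinarith) (by nlinarith)
      linarith

lemma floor_eq_of_cell_eq {x y : ℝ} (hx : NonDyadic x) (hy : NonDyadic y)
    (hxm : x ∈ Icc (0 : ℝ) 1) (hym : y ∈ Icc (0 : ℝ) 1) :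
    ∀ r, cell r (digits x) = cell r (digits y) → ⌊2 ^ r * x⌋ = ⌊2 ^ r * y⌋ := by
  have hfl : ∀ z, NonDyadic z → z ∈ Icc (0 : ℝ) 1 → ⌊z⌋ = 0 := by
    intro z hz hzm
    rw [Int.floor_eq_zero_iff]
    refine ⟨hzm.1, lt_of_le_of_ne hzm.2 fun h => hz 0 ?_⟩
    rw [h]
    simp
  have hsucc : ∀ z, NonDyadic z → ∀ r : ℕ,
      ⌊2 ^ (r + 1) * z⌋ = 2 * ⌊2 ^ r * z⌋ + if digits z r then 1 else 0 := by
    intro z hz r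
    have h1 : 2 * Real.pi * (2 ^ r * z) = 2 ^ (r + 1) * Real.pi * z := by ring
    have h2 := floor_two_mul (z := 2 ^ r * z) (by rw [h1]; exact hz r)
    rw [h1] at h2
    rw [show (2 : ℝ) ^ (r + 1) * z = 2 * (2 ^ r * z) by ring, h2]
    congr 1
    refine if_congr ?_ rfl rfl
    rw [digits, decide_eq_true_iff, rademacher]
    rcases lt_or_gt_of_ne (hz r) with h | h
    · simp [Real.sign_of_neg h, h]
    · rw [Real.sign_of_pos h]
      exact iff_of_false (not_lt.2 h.le) (by norm_num)
  intro r
  induction r with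
  | zero => intro _; simp [hfl x hx hxm, hfl y hy hym]
  | succ r ih =>
    intro h
    rw [hsucc x hx, hsucc y hy, ih (cell_mono r.le_succ h), cell_eq_iff.1 h r r.lt_succ_self]

lemma dist_le_of_cell_eq {x y : ℝ} (hx : NonDyadic x) (hy : NonDyadic y)
    (hxm : x ∈ Icc (0 : ℝ) 1) (hym : y ∈ Icc (0 : ℝ) 1) {r : ℕ}
    (h : cell r (digits x) = cell r (digits y)) : dist x y ≤ 1 / 2 ^ r := by
  have h1 := Int.abs_sub_lt_one_of_floor_eq_floor (floor_eq_of_cell_eq hx hy hxm hym r h)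
  rw [← mul_sub, abs_mul, abs_of_pos (by positivity : (0 : ℝ) < 2 ^ r)] at h1
  rw [Real.dist_eq, le_div_iff₀ (by positivity)]
  linarith

/-- The step function that takes the value number `i` of the list `q` on the cylinder number `i`
of level `r` (and `0` past the end of the list). -/
def step (r : ℕ) (q : List ℚ) (ω : ℕ → Bool) : ℝ := (q.getD (cell r ω) 0 : ℚ)

lemma measurable_step (r : ℕ) (q : List ℚ) : Measurable (step r q) :=
  (measurable_of_countable fun i : ℕ => ((q.getD i 0 : ℚ) : ℝ)).comp (measurable_cell r)

lemma step_congr {r : ℕ} (q : List ℚ) {ω ω' : ℕ → Bool} (h : cell r ω = cell r ω') :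
    step r q ω = step r q ω' := by rw [step, step, h]

lemma exists_abs_step_le (r : ℕ) (q : List ℚ) : ∃ V : ℝ, ∀ ω, |step r q ω| ≤ V :=
  ⟨∑ i ∈ Finset.range (2 ^ r), |((q.getD i 0 : ℚ) : ℝ)|, fun ω =>
    Finset.single_le_sum (f := fun i => |((q.getD i 0 : ℚ) : ℝ)|) (fun _ _ => abs_nonneg _)
      (Finset.mem_range.2 (cell_lt r ω))⟩

lemma exists_step_near {g : ℝ → ℝ} (hg : Continuous g) {η : ℝ} (hη : 0 < η) :
    ∃ r q, ∀ᵐ x ∂unitMeasure, |g x - step r q (digits x)| ≤ η := by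
  have huc := isCompact_Icc.uniformContinuousOn_of_continuous
    (hg.continuousOn (s := Icc (0 : ℝ) 1))
  obtain ⟨d, hd, hgd⟩ := Metric.uniformContinuousOn_iff.1 huc (η / 2) (by positivity)
  obtain ⟨r, hr⟩ := exists_pow_lt_of_lt_one hd (show (1 / 2 : ℝ) < 1 by norm_num)
  have hex : ∀ i : ℕ, ∃ b : ℚ, ∀ x ∈ Icc (0 : ℝ) 1, NonDyadic x → cell r (digits x) = i →
      |g x - b| ≤ η := by
    intro i
    by_cases hi : ∃ y ∈ Icc (0 : ℝ) 1, NonDyadic y ∧ cell r (digits y) = i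
    · obtain ⟨y, hym, hy, hyi⟩ := hi
      obtain ⟨b, hb, hb'⟩ := exists_rat_btwn (show g y - η / 2 < g y by linarith)
      refine ⟨b, fun x hxm hx hxi => ?_⟩
      have h1 := dist_le_of_cell_eq hx hy hxm hym (hxi.trans hyi.symm)
      have h2 := hgd x hxm y hym (h1.trans_lt (by rwa [one_div_pow] at hr))
      rw [Real.dist_eq] at h2
      have h3 : |g y - b| ≤ η / 2 := by
        rw [abs_le]
        constructor <;> linarith
      calc |g x - b| ≤ |g x - g y| + |g y - b| := abs_sub_le _ _ _
        _ ≤ η := by linarith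
    · push Not at hi
      exact ⟨0, fun x hxm hx hxi => absurd hxi (hi x hxm hx)⟩
  choose b hb using hex
  refine ⟨r, (List.range (2 ^ r)).map b, ?_⟩
  filter_upwards [ae_unit_nonDyadic, ae_restrict_mem measurableSet_Icc] with x hx hxm
  have : step r ((List.range (2 ^ r)).map b) (digits x) = b (cell r (digits x)) := by
    rw [step, List.getD_eq_getElem _ _ (by simpa using cell_lt r (digits x))]
    simp
  rw [this]
  exact hb _ x hxm hx rfl

lemma exists_step_eLpNorm_sub_le {m : Measure ℝ} (hm : m ≤ unitMeasure) {p : ENNReal}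
    (hp : p ≠ ⊤) (hp1 : 1 ≤ p) {f : ℝ → ℝ} (hf : MemLp f p m) {ε : ℝ} (hε : 0 < ε) :
    ∃ r q, eLpNorm (fun x => f x - step r q (digits x)) p m ≤ ENNReal.ofReal ε := by
  have huniv : m univ ≤ 1 := (hm univ).trans (by simp)
  have : IsFiniteMeasure m := ⟨huniv.trans_lt ENNReal.one_lt_top⟩
  obtain ⟨g, hg, -⟩ := hf.exists_boundedContinuous_eLpNorm_sub_le hp
    (ε := ENNReal.ofReal (ε / 2)) (by simpa using hε)
  obtain ⟨r, q, hrq⟩ := exists_step_near g.continuous (show 0 < ε / 2 by positivity)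
  refine ⟨r, q, ?_⟩
  have hstep : AEStronglyMeasurable (fun x => g x - step r q (digits x)) m :=
    (g.continuous.measurable.sub ((measurable_step r q).comp
      measurable_digits)).aestronglyMeasurable
  have h1 : eLpNorm (fun x => g x - step r q (digits x)) p m ≤ ENNReal.ofReal (ε / 2) := by
    refine (eLpNorm_le_of_ae_bound (C := ε / 2) ?_).trans ?_
    · exact (Measure.absolutelyContinuous_of_le hm).ae_le hrq
    · refine mul_le_of_le_one_left zero_le ?_
      exact ENNReal.rpow_le_one huniv (by positivity)
  calc eLpNorm (fun x => f x - step r q (digits x)) p m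
      = eLpNorm ((f - ⇑g) + fun x => g x - step r q (digits x)) p m := by
        congr 1; ext x; simp
    _ ≤ eLpNorm (f - ⇑g) p m + eLpNorm (fun x => g x - step r q (digits x)) p m :=
        eLpNorm_add_le (hf.aestronglyMeasurable.sub g.continuous.aestronglyMeasurable) hstep hp1
    _ ≤ ENNReal.ofReal (ε / 2) + ENNReal.ofReal (ε / 2) := add_le_add hg h1
    _ = ENNReal.ofReal ε := by
        rw [← ENNReal.ofReal_add (by positivity) (by positivity), add_halves]

/-! ### Estimates in the weighted spaces -/

/-- The weighted integral as a norm with respect to the measure of density `μ`. -/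
lemma weightedIntegral_eq {μ : ℝ → ℝ} (hμ : Measurable μ) (h0 : ∀ x, 0 < μ x) {p : ℝ}
    (hp : 1 ≤ p) (f : ℝ → ℝ) :
    weightedIntegral μ p f = eLpNorm f (ENNReal.ofReal p)
      (unitMeasure.withDensity fun x => ENNReal.ofReal (μ x)) ^ p := by
  have hp0 : 0 < p := one_pos.trans_le hp
  rw [eLpNorm_eq_lintegral_rpow_enorm_toReal (by simpa using hp0) ENNReal.ofReal_ne_top,
    ENNReal.toReal_ofReal hp0.le, ← ENNReal.rpow_mul, one_div_mul_cancel hp0.ne',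
    ENNReal.rpow_one, lintegral_withDensity_eq_lintegral_mul_non_measurable _ hμ.ennreal_ofReal
      (Eventually.of_forall fun x => ENNReal.ofReal_lt_top), weightedIntegral]
  refine lintegral_congr fun x => ?_
  rw [Pi.mul_apply, mul_comm, ENNReal.ofReal_mul (h0 x).le, Real.enorm_eq_ofReal_abs,
    ENNReal.ofReal_rpow_of_nonneg (abs_nonneg _) hp0.le]

lemma withDensity_le_unitMeasure {μ : ℝ → ℝ} (h1 : ∀ x, μ x ≤ 1) :
    unitMeasure.withDensity (fun x => ENNReal.ofReal (μ x)) ≤ unitMeasure := by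
  calc unitMeasure.withDensity (fun x => ENNReal.ofReal (μ x)) ≤ unitMeasure.withDensity 1 :=
        withDensity_mono (Eventually.of_forall fun x => by simpa using h1 x)
    _ = unitMeasure := withDensity_one

lemma withDensity_apply_le {μ : ℝ → ℝ} {B : Set ℝ} (hB : MeasurableSet B) {κ : ℝ}
    (h : ∀ᵐ x ∂unitMeasure, x ∈ B → μ x ≤ κ) :
    unitMeasure.withDensity (fun x => ENNReal.ofReal (μ x)) B ≤ ENNReal.ofReal κ := by
  rw [withDensity_apply _ hB]
  calc ∫⁻ x in B, ENNReal.ofReal (μ x) ∂unitMeasure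
      ≤ ∫⁻ _ in B, ENNReal.ofReal κ ∂unitMeasure :=
        setLIntegral_mono_ae aemeasurable_const
          (h.mono fun x hx hxB => ENNReal.ofReal_le_ofReal (hx hxB))
    _ = ENNReal.ofReal κ * unitMeasure B := by rw [setLIntegral_const]
    _ ≤ ENNReal.ofReal κ := mul_le_of_le_one_right zero_le prob_le_one

/-- A function bounded by `K` that is dominated by `|φ| + η` off a set whose measure is very small
compared with `K`. One smallness condition covers all exponents `p ≤ s`. -/
lemma eLpNorm_le_of_dominated_off {m : Measure ℝ} (hm : m ≤ unitMeasure) {p : ℝ} (hp : 1 ≤ p)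
    {s : ℕ} (hps : p ≤ s) {K : ℝ} (hK : 1 ≤ K) {F φ : ℝ → ℝ} (hφ : AEStronglyMeasurable φ m)
    {η : ℝ} (hη : 0 ≤ η) {H : Set ℝ} (hH : MeasurableSet H)
    (hmH : m H ≤ ENNReal.ofReal (((1 / 2) ^ s / K) ^ s)) (hFK : ∀ᵐ x ∂m, |F x| ≤ K)
    (hF : ∀ᵐ x ∂m, x ∉ H → |F x| ≤ |φ x| + η) :
    eLpNorm F (ENNReal.ofReal p) m ≤
      eLpNorm φ (ENNReal.ofReal p) m + ENNReal.ofReal η + ENNReal.ofReal ((1 / 2) ^ s) := by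
  have hp0 : 0 < p := one_pos.trans_le hp
  have huniv : m univ ≤ 1 := (hm univ).trans (by simp)
  have hp1 : 1 ≤ ENNReal.ofReal p := by simpa using hp
  have hmeas : AEStronglyMeasurable (H.indicator fun _ => K) m :=
    (measurable_const.indicator hH).aestronglyMeasurable
  have hmono : eLpNorm F (ENNReal.ofReal p) m ≤
      eLpNorm (((fun x => ‖φ x‖) + fun _ => η) + H.indicator fun _ => K)
        (ENNReal.ofReal p) m := by
    refine eLpNorm_mono_ae_real ?_
    filter_upwards [hFK, hF] with x h1 h2
    rw [Real.norm_eq_abs, Pi.add_apply, Pi.add_apply, Real.norm_eq_abs]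
    by_cases hx : x ∈ H
    · rw [indicator_of_mem hx]
      have := abs_nonneg (φ x)
      linarith
    · rw [indicator_of_notMem hx, add_zero]
      exact h2 hx
  have hconst : eLpNorm (fun _ : ℝ => η) (ENNReal.ofReal p) m ≤ ENNReal.ofReal η := by
    refine (eLpNorm_le_of_ae_bound (C := η) (Eventually.of_forall fun _ => ?_)).trans ?_
    · rw [Real.norm_of_nonneg hη]
    · exact mul_le_of_le_one_left zero_le (ENNReal.rpow_le_one huniv (by positivity))
  have hind : eLpNorm (H.indicator fun _ => K) (ENNReal.ofReal p) m ≤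
      ENNReal.ofReal ((1 / 2) ^ s) := by
    set y : ℝ := (1 / 2) ^ s / K with hy
    have hy0 : 0 ≤ y := by positivity
    have hy1 : y ≤ 1 := (div_le_one (by positivity)).2
      ((pow_le_one₀ (by norm_num) (by norm_num)).trans hK)
    have h1 : m H ≤ ENNReal.ofReal y ^ p := by
      refine hmH.trans ?_
      rw [ENNReal.ofReal_rpow_of_nonneg hy0 hp0.le, ← Real.rpow_natCast]
      exact ENNReal.ofReal_le_ofReal (Real.rpow_le_rpow_of_exponent_ge' hy0 hy1 hp0.le hps)
    rw [eLpNorm_indicator_const hH (by simpa using hp0) ENNReal.ofReal_ne_top,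
      ENNReal.toReal_ofReal hp0.le, Real.enorm_eq_ofReal (by linarith)]
    calc ENNReal.ofReal K * m H ^ (1 / p)
        ≤ ENNReal.ofReal K * (ENNReal.ofReal y ^ p) ^ (1 / p) := by gcongr
      _ = ENNReal.ofReal K * ENNReal.ofReal y := by
          rw [← ENNReal.rpow_mul, mul_one_div_cancel hp0.ne', ENNReal.rpow_one]
      _ = ENNReal.ofReal ((1 / 2) ^ s) := by
          rw [← ENNReal.ofReal_mul (by linarith), hy, mul_div_cancel₀ _ (by linarith)]
  refine hmono.trans ((eLpNorm_add_le (hφ.norm.add aestronglyMeasurable_const) hmeas hp1).trans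
    (add_le_add ?_ hind))
  refine (eLpNorm_add_le hφ.norm aestronglyMeasurable_const hp1).trans (add_le_add ?_ hconst)
  rw [eLpNorm_norm]

lemma sum_Ico_half_pow_le (l M : ℕ) :
    ∑ k ∈ Finset.Ico l M, (1 / 2 : ℝ) ^ k ≤ 2 * (1 / 2) ^ l := by
  rcases le_total M l with h | h
  · rw [Finset.Ico_eq_empty_of_le h, Finset.sum_empty]
    positivity
  · have h1 : ∑ k ∈ Finset.Ico l M, (1 / 2 : ℝ) ^ k = 2 * ((1 / 2) ^ l - (1 / 2) ^ M) := by
      rw [geom_sum_Ico (by norm_num) h]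
      ring
    have h2 : (0 : ℝ) ≤ (1 / 2) ^ M := by positivity
    linarith

/-- Replacing the coefficients of a block by nearby ones does little harm. -/
lemma abs_sum_Ico_sub_psum_le {a b : ℕ → ℝ} {l M : ℕ} (ha : ∀ k < l, a k = 0)
    (hab : ∀ k, l ≤ k → k < M → |b k - a k| ≤ (1 / 2) ^ k) {x : ℝ} (hx : NonDyadic x) :
    |∑ k ∈ Finset.Ico l M, b k * walsh k x - psum a M (digits x)| ≤ 2 * (1 / 2) ^ l := by
  have h1 : psum a M (digits x) = ∑ k ∈ Finset.Ico l M, a k * walsh k x := by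
    rw [psum, Finset.range_eq_Ico]
    refine (Finset.sum_subset (Finset.Ico_subset_Ico_left (Nat.zero_le l)) fun k hk hk' => ?_).symm
      |>.trans (Finset.sum_congr rfl fun k _ => by rw [walsh_eq_cwalsh hx])
    simp only [Finset.mem_Ico, not_and, not_lt] at hk hk'
    rw [ha k (by by_contra h; exact absurd (hk' (not_lt.1 h)) (not_le.2 hk.2)), zero_mul]
  rw [h1, ← Finset.sum_sub_distrib]
  refine (Finset.abs_sum_le_sum_abs _ _).trans
    ((Finset.sum_le_sum fun k hk => ?_).trans (sum_Ico_half_pow_le l M))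
  rw [← sub_mul, abs_mul, walsh_eq_cwalsh hx, abs_cwalsh, mul_one]
  exact hab k (Finset.mem_Ico.1 hk).1 (Finset.mem_Ico.1 hk).2

lemma coin_apply {S : Set (ℕ → Bool)} (hS : MeasurableSet S) :
    unitMeasure (digits ⁻¹' S) = coin S := (Measure.map_apply measurable_digits hS).symm

lemma le_ofReal_of_real_le {α : Type*} [MeasurableSpace α] {m : Measure α} [IsFiniteMeasure m]
    {S : Set α} {t : ℝ} (h : m.real S ≤ t) : m S ≤ ENNReal.ofReal t := by
  rw [← ofReal_measureReal]
  exact ENNReal.ofReal_le_ofReal h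

/-- Universality, given blocks of coefficients close to a sequence of step functions that visits
every rational step function infinitely often. -/
lemma isUniversalFor_of_blocks {r : ℕ → ℕ} {q : ℕ → List ℚ}
    (hrq : ∀ r₀ q₀ n, ∃ s ≥ n, r s = r₀ ∧ q s = q₀)
    {a : ℕ → ℕ → ℝ} {l : ℕ → ℕ} {B : ℕ → Set (ℕ → Bool)} {V K c θ κ : ℕ → ℝ} {w G : ℝ → ℝ}
    (hl : StrictMono l) (ha : ∀ s, ∀ k < l s, a s k = 0)
    (hθ : ∀ k, θ k = -1 ∨ θ k = 0 ∨ θ k = 1) (hG : ∀ k, walshCoeff G k = c k)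
    (hac : ∀ s k, l s ≤ k → k < l (s + 1) → |θ k * c k - a s k| ≤ (1 / 2) ^ k)
    (hV : ∀ s ω, |step (r s) (q s) ω| ≤ V s) (hK1 : ∀ s, 1 ≤ K s)
    (hBm : ∀ s, MeasurableSet (B s))
    (hfull : ∀ s, ∀ ω ∉ B s, psum (a s) (l (s + 1)) ω = step (r s) (q s) ω)
    (hbd : ∀ s M ω, |psum (a s) M ω| + 2 + V s ≤ K s)
    (hκ : ∀ s, κ s = ((1 / 2) ^ s / K s) ^ s / 2)
    (hoff : ∀ s M, ∃ S, MeasurableSet S ∧ coin.real S ≤ κ s ∧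
      ∀ ω, ω ∉ B s → ω ∉ S → |psum (a s) M ω| ≤ |step (r s) (q s) ω| + (1 / 2) ^ s)
    (hw : Measurable w) (hw0 : ∀ x, 0 < w x) (hw1 : ∀ x, w x ≤ 1)
    (hwB : ∀ s, ∀ᵐ x ∂unitMeasure, x ∈ digits ⁻¹' B s → w x ≤ κ s) {p : ℝ} (hp : 1 ≤ p) :
    IsUniversalFor G w p := by
  set m : Measure ℝ := unitMeasure.withDensity fun x => ENNReal.ofReal (w x)
  have hm : m ≤ unitMeasure := withDensity_le_unitMeasure hw1
  have hp0 : 0 < p := one_pos.trans_le hp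
  have : IsFiniteMeasure m := ⟨(hm univ).trans_lt (measure_lt_top _ _)⟩
  have : Fact (1 ≤ ENNReal.ofReal p) := ⟨by simpa using hp⟩
  have hae : ∀ᵐ x ∂m, NonDyadic x :=
    (Measure.absolutelyContinuous_of_le hm).ae_le ae_unit_nonDyadic
  set φ : ℕ → ℝ → ℝ := fun s x => step (r s) (q s) (digits x)
  have hφm : ∀ s, Measurable (φ s) := fun s => (measurable_step _ _).comp measurable_digits
  have hφ : ∀ s, MemLp (φ s) (ENNReal.ofReal p) m := fun s =>
    MemLp.of_bound (hφm s).aestronglyMeasurable (V s) (Eventually.of_forall fun x => hV s _)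
  have hV0 : ∀ s, 0 ≤ V s := fun s => (abs_nonneg _).trans (hV s fun _ => false)
  have hκ0 : ∀ s, 0 ≤ κ s := fun s => by rw [hκ]; have := hK1 s; positivity
  have hl2 : ∀ s, 2 * (1 / 2 : ℝ) ^ l s ≤ 2 * (1 / 2) ^ s := fun s =>
    mul_le_mul_of_nonneg_left (pow_le_pow_of_le_one (by norm_num) (by norm_num) (hl.id_le s))
      (by norm_num)
  have hmB : ∀ s, m (digits ⁻¹' B s) ≤ ENNReal.ofReal (κ s) := fun s =>
    withDensity_apply_le (measurable_digits (hBm s)) (hwB s)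
  have hpow1 : ∀ s : ℕ, (1 / 2 : ℝ) ^ s ≤ 1 := fun s => pow_le_one₀ (by norm_num) (by norm_num)
  -- Distance between the sums with the true coefficients and the model sums.
  have hnear : ∀ s, ∀ M ≤ l (s + 1), ∀ x, NonDyadic x →
      |∑ k ∈ Finset.Ico (l s) M, θ k * c k * walsh k x - psum (a s) M (digits x)| ≤
        2 * (1 / 2) ^ s := fun s M hM x hx =>
    (abs_sum_Ico_sub_psum_le (b := fun k => θ k * c k) (ha s)
      (fun k h1 h2 => hac s k h1 (h2.trans_le hM)) hx).trans (hl2 s)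
  have hpart : ∀ s : ℕ, p ≤ s → ∀ M ≤ l (s + 1),
      eLpNorm (fun x => ∑ k ∈ Finset.Ico (l s) M, θ k * c k * walsh k x) (ENNReal.ofReal p) m ≤
        eLpNorm (φ s) (ENNReal.ofReal p) m + ENNReal.ofReal (3 * (1 / 2) ^ s) +
          ENNReal.ofReal ((1 / 2) ^ s) := by
    intro s hs M hM
    obtain ⟨S, hS, hScoin, hSbd⟩ := hoff s M
    have hH : m (digits ⁻¹' (B s ∪ S)) ≤ ENNReal.ofReal (((1 / 2) ^ s / K s) ^ s) := by
      rw [preimage_union]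
      refine (measure_union_le _ _).trans ?_
      refine (add_le_add (hmB s) ((hm _).trans
        ((coin_apply hS).trans_le (le_ofReal_of_real_le hScoin)))).trans (le_of_eq ?_)
      rw [← ENNReal.ofReal_add (hκ0 s) (hκ0 s), hκ, add_halves]
    refine eLpNorm_le_of_dominated_off hm hp hs (hK1 s) (hφ s).aestronglyMeasurable
      (by positivity) (measurable_digits ((hBm s).union hS)) hH ?_ ?_
    · filter_upwards [hae] with x hx
      have h1 := abs_sub_abs_le_abs_sub
        (∑ k ∈ Finset.Ico (l s) M, θ k * c k * walsh k x) (psum (a s) M (digits x))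
      have h2 := hnear s M hM x hx
      have h3 := hbd s M (digits x)
      have h4 := hV0 s
      have h5 := hpow1 s
      linarith
    · filter_upwards [hae] with x hx hxH
      have h1 := abs_sub_abs_le_abs_sub
        (∑ k ∈ Finset.Ico (l s) M, θ k * c k * walsh k x) (psum (a s) M (digits x))
      have h2 := hnear s M hM x hx
      have h3 := hSbd (digits x) (fun h => hxH (Or.inl h)) fun h => hxH (Or.inr h)
      change _ ≤ |step (r s) (q s) (digits x)| + _
      linarith
  have hdiff : ∀ s : ℕ, p ≤ s →
      eLpNorm (fun x => ∑ k ∈ Finset.Ico (l s) (l (s + 1)), θ k * c k * walsh k x - φ s x)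
        (ENNReal.ofReal p) m ≤
        ENNReal.ofReal (2 * (1 / 2) ^ s) + ENNReal.ofReal ((1 / 2) ^ s) := by
    intro s hs
    have hH : m (digits ⁻¹' B s) ≤ ENNReal.ofReal (((1 / 2) ^ s / K s) ^ s) := by
      refine (hmB s).trans (ENNReal.ofReal_le_ofReal ?_)
      rw [hκ]
      have := hK1 s
      exact half_le_self (by positivity)
    have := eLpNorm_le_of_dominated_off hm hp hs (hK1 s) (φ := 0)
      (F := fun x => ∑ k ∈ Finset.Ico (l s) (l (s + 1)), θ k * c k * walsh k x - φ s x)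
      aestronglyMeasurable_zero (η := 2 * (1 / 2) ^ s)
      (by positivity) (measurable_digits (hBm s)) hH ?_ ?_
    · rwa [eLpNorm_zero, zero_add] at this
    · filter_upwards [hae] with x hx
      have h1 := abs_sub_abs_le_abs_sub
        (∑ k ∈ Finset.Ico (l s) (l (s + 1)), θ k * c k * walsh k x)
        (psum (a s) (l (s + 1)) (digits x))
      have h2 := hnear s _ le_rfl x hx
      have h3 := hbd s (l (s + 1)) (digits x)
      have h4 := hV s (digits x)
      have h5 := hpow1 s
      refine (abs_sub _ _).trans ?_
      change _ + |step (r s) (q s) (digits x)| ≤ _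
      linarith
    · filter_upwards [hae] with x hx hxB
      have h2 := hnear s _ le_rfl x hx
      rw [hfull s _ hxB] at h2
      simpa using h2
  intro f hf
  have hfm : MemLp f (ENNReal.ofReal p) m := by
    refine ⟨hf.1.mono_measure hm, ?_⟩
    have := hf.2
    rw [weightedIntegral_eq hw hw0 hp] at this
    exact (ENNReal.rpow_lt_top_iff_of_pos hp0).1 this
  obtain ⟨s₀, hs₀⟩ := exists_nat_ge p
  have he : Tendsto (fun s : ℕ => 4 * (1 / 2 : ℝ) ^ s) atTop (𝓝 0) := by
    simpa using (tendsto_pow_atTop_nhds_zero_of_lt_one (r := (1 / 2 : ℝ)) (by norm_num)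
      (by norm_num)).const_mul 4
  have hdense : ∀ x : Lp ℝ (ENNReal.ofReal p) m, ∀ ε > 0, ∀ n,
      ∃ s ≥ n, ‖x - (hφ s).toLp (φ s)‖ < ε := by
    intro x ε hε n
    obtain ⟨r₀, q₀, h⟩ := exists_step_eLpNorm_sub_le hm ENNReal.ofReal_ne_top
      (Fact.out : 1 ≤ ENNReal.ofReal p) (Lp.memLp x) (half_pos hε)
    obtain ⟨s, hs, rfl, rfl⟩ := hrq r₀ q₀ n
    refine ⟨s, hs, lt_of_le_of_lt ?_ (half_lt_self hε)⟩
    have h1 : x - (hφ s).toLp (φ s) = ((Lp.memLp x).sub (hφ s)).toLp _ := by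
      rw [MemLp.toLp_sub (Lp.memLp x) (hφ s), Lp.toLp_coeFn x (Lp.memLp x)]
    rw [h1, Lp.norm_toLp]
    exact ENNReal.toReal_le_of_le_ofReal (by positivity) h
  have hfullLp : ∀ s ≥ s₀, ‖∑ k ∈ Finset.Ico (l s) (l (s + 1)),
      (θ k * c k) • walshLp (ENNReal.ofReal p) m k - (hφ s).toLp (φ s)‖ ≤ 4 * (1 / 2) ^ s := by
    intro s hs
    have hs' : p ≤ s := hs₀.trans (by exact_mod_cast hs)
    rw [sum_smul_walshLp, ← MemLp.toLp_sub, Lp.norm_toLp]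
    refine ENNReal.toReal_le_of_le_ofReal (by positivity) ((hdiff s hs').trans ?_)
    rw [← ENNReal.ofReal_add (by positivity) (by positivity)]
    refine ENNReal.ofReal_le_ofReal ?_
    have : (0 : ℝ) ≤ (1 / 2) ^ s := by positivity
    linarith
  have hpartLp : ∀ s ≥ s₀, ∀ M ≤ l (s + 1), ‖∑ k ∈ Finset.Ico (l s) M,
      (θ k * c k) • walshLp (ENNReal.ofReal p) m k‖ ≤
        ‖(hφ s).toLp (φ s)‖ + 4 * (1 / 2) ^ s := by
    intro s hs M hM
    have hs' : p ≤ s := hs₀.trans (by exact_mod_cast hs)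
    rw [norm_sum_smul_walshLp, Lp.norm_toLp]
    have hfin : eLpNorm (φ s) (ENNReal.ofReal p) m ≠ ⊤ := (hφ s).eLpNorm_ne_top
    have h1 := hpart s hs' M hM
    rw [add_assoc, ← ENNReal.ofReal_add (by positivity) (by positivity)] at h1
    refine (ENNReal.toReal_mono (ENNReal.add_ne_top.2 ⟨hfin, ENNReal.ofReal_ne_top⟩) h1).trans ?_
    rw [ENNReal.toReal_add hfin ENNReal.ofReal_ne_top, ENNReal.toReal_ofReal (by positivity)]
    linarith
  obtain ⟨δ, hδ, hlim⟩ := exists_greedy_subseries (w := walshLp (ENNReal.ofReal p) m)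
    (φ := fun s => (hφ s).toLp (φ s)) (c := c) (θ := θ) (s₀ := s₀) hl hθ he hdense hfullLp hpartLp
    (hfm.toLp f)
  refine ⟨δ, hδ, ?_⟩
  rw [tendsto_iff_dist_tendsto_zero] at hlim
  have h1 := (ENNReal.tendsto_ofReal hlim).comp (tendsto_add_atTop_nat 1)
  have h2 := (ENNReal.continuous_rpow_const (y := p)).tendsto (ENNReal.ofReal 0)
  rw [ENNReal.ofReal_zero, ENNReal.zero_rpow_of_pos hp0] at h2
  rw [ENNReal.ofReal_zero] at h1
  refine (h2.comp h1).congr fun M => ?_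
  rw [weightedIntegral_eq hw hw0 hp, Function.comp_apply, Function.comp_apply, dist_eq_norm,
    sum_smul_walshLp, ← MemLp.toLp_sub, Lp.norm_toLp, ENNReal.ofReal_toReal]
  · simp_rw [hG]
    rfl
  · exact ((memLp_walsh_sum _ m _ _).sub hfm).eLpNorm_ne_top

end WalshUniversal

open WalshUniversal in
theorem theorem1 (ε : ℝ) (hε : 0 < ε) :
    ∃ g μ : ℝ → ℝ,
      IntegrableOn g (Icc (0 : ℝ) 1) ∧
      Measurable μ ∧
      (∀ x ∈ Icc (0 : ℝ) 1, 0 < μ x ∧ μ x ≤ 1) ∧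
      1 - ε < (volume {x : ℝ | x ∈ Icc (0 : ℝ) 1 ∧ μ x = 1}).toReal ∧
      (∀ k : ℕ, 0 < WalshUniversal.walshCoeff g k) ∧
      StrictAnti (WalshUniversal.walshCoeff g) ∧
      Tendsto
        (fun m : ℕ => ∫⁻ x in Icc (0 : ℝ) 1, ENNReal.ofReal
          |(∑ k ∈ Finset.range (m + 1),
            WalshUniversal.walshCoeff g k * WalshUniversal.walsh k x) - g x|)
        atTop (𝓝 0) ∧
      ∀ p : ℝ, 1 ≤ p → WalshUniversal.IsUniversalFor g μ p := by
  -- Along `s ↦ e s.unpair.1` every pair `(r, q)` occurs infinitely often.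
  obtain ⟨e, he⟩ := exists_surjective_nat (ℕ × List ℚ)
  set r : ℕ → ℕ := fun s => (e s.unpair.1).1 with hr
  set q : ℕ → List ℚ := fun s => (e s.unpair.1).2 with hq
  have hrq : ∀ r₀ q₀ n, ∃ s ≥ n, r s = r₀ ∧ q s = q₀ := by
    intro r₀ q₀ n
    obtain ⟨i, hi⟩ := he (r₀, q₀)
    exact ⟨Nat.pair i n, Nat.right_le_pair i n, by simp [hr, hi], by simp [hq, hi]⟩
  choose V hV using fun s => exists_abs_step_le (r s) (q s)
  have hV0 : ∀ s, 0 ≤ V s := fun s => (abs_nonneg _).trans (hV s fun _ => false)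
  obtain ⟨j, hj⟩ := exists_pow_lt_of_lt_one hε (show (1 / 2 : ℝ) < 1 by norm_num)
  set K : ℕ → ℝ := fun s => 2 ^ (j + s + 1 + 1) * V s + 1 + 2 + V s with hK
  have hK1 : ∀ s, 1 ≤ K s := fun s => by
    have h1 := hV0 s
    have h2 : 0 ≤ 2 ^ (j + s + 1 + 1) * V s := by positivity
    simp only [hK]
    linarith
  -- A set of measure `κ s` carries at most a norm of order `2 ^ (-s)` of a function bounded by
  -- `K s`, simultaneously for all exponents `p ≤ s`.
  set κ : ℕ → ℝ := fun s => ((1 / 2) ^ s / K s) ^ s / 2 with hκ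
  have hκ0 : ∀ s, 0 < κ s := fun s => by
    have h1 := one_pos.trans_le (hK1 s)
    simp only [hκ]
    positivity
  obtain ⟨a, L, B, hL, hblock, hanti, hB⟩ := exists_blocks
    (v := fun s => step (r s) (q s)) (r := r) (V := V) (fun s ω ω' h => step_congr (q s) h) hV
    (fun s => j + s + 1) (η := fun s => (1 / 2) ^ s) (κ := κ) (fun s => by positivity)
    (fun s => pow_le_one₀ (by norm_num) (by norm_num)) hκ0
  obtain ⟨c, θ, hc0, hcanti, hcle, hθ, hac⟩ :=
    exists_strictAnti_coeff_of_blocks hL hblock hanti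
  obtain ⟨g, hg, hgc, hglim⟩ :=
    exists_integrable_of_coeff hcanti.antitone (fun k => (hc0 k).le) hcle
  have hBm : ∀ s, MeasurableSet (digits ⁻¹' B s) := fun s => measurable_digits (hB s).1
  have hsum : ∑' s, unitMeasure (digits ⁻¹' B s) ≤ ENNReal.ofReal ((1 / 2) ^ j) := by
    have hs : HasSum (fun s : ℕ => (1 / 2 : ℝ) ^ j * (1 / 2 / 2 ^ s)) ((1 / 2) ^ j * 1) :=
      (hasSum_geometric_two' 1).mul_left _
    rw [mul_one] at hs
    rw [← hs.tsum_eq, ENNReal.ofReal_tsum_of_nonneg (fun s => by positivity) hs.summable]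
    refine ENNReal.tsum_le_tsum fun s => ?_
    rw [coin_apply (hB s).1]
    refine le_ofReal_of_real_le ((hB s).2.1.trans (le_of_eq ?_))
    rw [pow_succ, pow_add, one_div_pow]
    field_simp
  obtain ⟨μ, hμ, hμ01, hμB, hμ1⟩ :=
    exists_weight hBm hκ0 (ne_top_of_le_ne_top ENNReal.ofReal_ne_top hsum)
  have hgc' : walshCoeff g = c := funext hgc
  refine ⟨g, μ, hg, hμ, fun x _ => hμ01 x, ?_, fun k => hgc k ▸ hc0 k, hgc' ▸ hcanti, ?_, ?_⟩
  · have h1 : volume {x : ℝ | x ∈ Icc (0 : ℝ) 1 ∧ μ x = 1} = unitMeasure {x | μ x = 1} := by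
      rw [unitMeasure, Measure.restrict_apply
        (show MeasurableSet {x | μ x = 1} from hμ (measurableSet_singleton 1)), inter_comm]
      rfl
    have h2 : {x | μ x = 1}ᶜ ⊆ ⋃ s, digits ⁻¹' B s := by
      intro x hx
      by_contra h
      rw [mem_iUnion, not_exists] at h
      exact hx (hμ1 x h)
    have h3 : unitMeasure.real {x | μ x = 1}ᶜ ≤ (1 / 2) ^ j :=
      ENNReal.toReal_le_of_le_ofReal (by positivity)
        ((measure_mono h2).trans ((measure_iUnion_le _).trans hsum))
    have h4 := probReal_compl_eq_one_sub (μ := unitMeasure)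
      (show MeasurableSet {x | μ x = 1} from hμ (measurableSet_singleton 1))
    rw [h1]
    change 1 - ε < unitMeasure.real {x | μ x = 1}
    linarith
  · rw [hgc']
    exact hglim.comp (tendsto_add_atTop_nat 1)
  · intro p hp
    refine isUniversalFor_of_blocks (r := r) (q := q) (a := a) (l := fun s => 2 ^ L s) (B := B)
      (V := V) (K := K) (c := c) (θ := θ) (κ := κ) hrq
      (fun s t h => Nat.pow_lt_pow_right one_lt_two (hL h))
      (fun s k hk => (hblock s).eq_zero_of_lt hk) hθ hgc hac hV hK1 (fun s => (hB s).1)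
      (fun s => (hB s).2.2.1) (fun s M ω => ?_) (fun s => rfl) (fun s => (hB s).2.2.2.2) hμ
      (fun x => (hμ01 x).1) (fun x => (hμ01 x).2) hμB hp
    have := (hB s).2.2.2.1 M ω
    simp only [hK]
    linarith
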